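/- **Setting.** For $g:\mathbb R\to\mathbb R$ write $g_{jk}(x)=2^{j/2}g(2^jx-k)$, $j,k\in\mathbb Z$. Let $\varphi,\psi:\mathbb R\to\mathbb R$ be compactly supported, where $\varphi$ is a father wavelet (its integer translates are orthonormal, the closed spans $V_j$ in $L^2(\mathbb R)$ of $\{\varphi_{jk}:k\in\mathbb Z\}$ are nested, $V_j\subseteq V_{j+1}$, and their union is dense in $L^2(\mathbb R)$) and $\psi$ is an associated mother wavelet (its integer translates form an orthonormal basis of the orthogonal complement of $V_0$ in $V_1$). Let $N\ge 0$ be an integer such that $\varphi$ is $N+1$ times weakly differentiable with $\operatorname{ess\,sup}_x\sum_k|\varphi^{(N+1)}(x-k)|<\infty$, and such that $|\varphi(u)|\le\Phi(|u|)$ for all $u$, for some bounded non-increasing $\Phi$ on $[0,\infty)$ with $\int\Phi(|u|)\,du<\infty$ and $\int\Phi(|u|)|u|^N\,du<\infty$. For $0<s<N+1$, $1\le p,q\le\infty$ put $\alpha_{0k}=\int f\varphi_{0k}$, $\beta_{jk}=\int f\psi_{jk}$, $$J_{spq}(f)=\|\alpha_{0\cdot}\|_{\ell^p}+\Big\|\big(2^{j(s+1/2-1/p)}\|\beta_{j\cdot}\|_{\ell^p}\big)_{j\ge0}\Big\|_{\ell^q}\in[0,\infty],$$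 and for $L,T>0$ let $\mathcal D=\mathcal D^s_{pq}(L,T)$ be the set of probability densities $f$ on $\mathbb R$ with support contained in $[-T,T]$ and $J_{spq}(f)\le L$. Let $\mathcal Q_\alpha$ be the set of local $\alpha$-differentially private mechanisms: sequences of Markov kernels $Q_i$ from $\mathcal Z^{i-1}\times\mathbb R$ to an arbitrary measurable space $\mathcal Z$ such that $Q_i(A\mid x,z_1,\dots,z_{i-1})\le e^{\alpha}Q_i(A\mid x',z_1,\dots,z_{i-1})$ for all $i$, all $x,x'\in\mathbb R$, all $z_1,\dots,z_{i-1}\in\mathcal Z$ and all measurable $A$. Given i.i.d. $X_1,\dots,X_n$ with density $f$, the private views are drawn successively as $Z_i\sim Q_i(\cdot\mid X_i,Z_1,\dots,Z_{i-1})$. Expectation under this model is written $\mathbb E_{f,Q}$. **Proposition.** Let $r\ge1$, $1\le p,q\le\infty$, $s>0$, $1/p\le s<N+1$, $L,T>0$, and suppose that $L$ is not degenerate, that is, some probability density $f$ supported in $[-T,T]$ satisfies $J_{spq}(f)<L$. Then there are constants $C>0$ and $m_0$, depending only on $\varphi,\psi,N,s,p,q,r,L,T$, such that for all $\alpha>0$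 and all integers $n\ge 0$ with $n(e^\alpha-1)^2\ge m_0$, $$\inf_{\widetilde f,\;Q\in\mathcal Q_\alpha}\ \sup_{f\in\mathcal D^s_{pq}(L,T)}\mathbb E_{f,Q}\|\widetilde f-f\|_r^r\ \ge\ C\left(\frac{\log\big(n(e^\alpha-1)^2\big)}{n(e^\alpha-1)^2}\right)^{r\,\frac{s-1/p+1/r}{2(s-1/p)+2}},$$ where the infimum is over all mechanisms $Q\in\mathcal Q_\alpha$ and all estimators $\widetilde f$ based on the private views $Z_1,\dots,Z_n$ (jointly measurable functions of $(Z_1,\dots,Z_n)$ and $x$). In particular, for every fixed $\alpha\in(0,\infty)$ the bound holds for all sufficiently large $n$. -/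

import Mathlib

open MeasureTheory ProbabilityTheory
open scoped ENNReal

universe u

noncomputable section

namespace LDPBesov

/-! ### Wavelets -/

/-- The dilated and translated function `g_{jk}(x) = 2^{j/2} g(2^j x - k)`. -/
def dyadic (g : ℝ → ℝ) (j k : ℤ) (x : ℝ) : ℝ :=
  (2 : ℝ) ^ ((j : ℝ) / 2) * g ((2 : ℝ) ^ j * x - (k : ℝ))

/-- The closed linear span in `L²(ℝ)` of the functions `g_{jk}`, `k ∈ ℤ`, at resolution level `j`. -/
def levelSpace (g : ℝ → ℝ) (j : ℤ) : Submodule ℝ (Lp ℝ 2 (volume : Measure ℝ)) :=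
  (Submodule.span ℝ {u : Lp ℝ 2 (volume : Measure ℝ) |
    ∃ k : ℤ, ⇑u =ᵐ[volume] dyadic g j k}).topologicalClosure

/-- `g` is square integrable and its integer translates form an orthonormal system of `L²(ℝ)`. -/
def OrthonormalTranslates (g : ℝ → ℝ) : Prop :=
  MemLp g 2 volume ∧
    ∀ k l : ℤ, ∫ x, dyadic g 0 k x * dyadic g 0 l x = if k = l then 1 else 0

/-- `φ` is a father wavelet: it generates a multiresolution analysis of `L²(ℝ)`. -/
structure GeneratesMRA (φ : ℝ → ℝ) : Prop where
  orthonormal : OrthonormalTranslates φ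
  nested : ∀ j : ℤ, levelSpace φ j ≤ levelSpace φ (j + 1)
  dense : (⨆ j : ℤ, levelSpace φ j).topologicalClosure = ⊤

/-- `ψ` is a mother wavelet associated with the father wavelet `φ`: its integer translates form
an orthonormal basis of the orthogonal complement of `V₀` in `V₁`. -/
structure IsMotherWavelet (φ ψ : ℝ → ℝ) : Prop where
  orthonormal : OrthonormalTranslates ψ
  span_eq : levelSpace ψ 0 = (levelSpace φ 0)ᗮ ⊓ levelSpace φ 1

/-- The locally integrable function `g` is the weak derivative of order `m` of `f`. -/
def IsWeakDeriv (m : ℕ) (f g : ℝ → ℝ) : Prop :=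
  LocallyIntegrable f volume ∧ LocallyIntegrable g volume ∧
    ∀ θ : ℝ → ℝ, ContDiff ℝ (⊤ : ℕ∞) θ → HasCompactSupport θ →
      ∫ x, f x * iteratedDeriv m θ x = (-1) ^ m * ∫ x, g x * θ x

/-- Regularity of order `N + 1` and decay of the father wavelet. -/
structure FatherRegular (N : ℕ) (φ : ℝ → ℝ) : Prop where
  weakDeriv : ∃ g : ℝ → ℝ, IsWeakDeriv (N + 1) φ g ∧
    ∃ B : ℝ, ∀ᵐ x ∂(volume : Measure ℝ), ∑' k : ℤ, ‖g (x - (k : ℝ))‖ₑ ≤ ENNReal.ofReal B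
  decay : ∃ Φ : ℝ → ℝ, AntitoneOn Φ (Set.Ici 0) ∧ (∃ B : ℝ, ∀ u, 0 ≤ u → |Φ u| ≤ B) ∧
    (∀ u, |φ u| ≤ Φ |u|) ∧
    Integrable (fun u => Φ |u|) volume ∧ Integrable (fun u => Φ |u| * |u| ^ N) volume

/-- `φ` and `ψ` generate a compactly supported orthonormal wavelet basis of `L²(ℝ)` whose father
wavelet is regular of order `N + 1`. -/
structure IsWaveletPair (N : ℕ) (φ ψ : ℝ → ℝ) : Prop where
  mra : GeneratesMRA φ
  regular : FatherRegular N φ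
  mother : IsMotherWavelet φ ψ
  compact : ∃ A : ℝ, ∀ x, A < |x| → φ x = 0 ∧ ψ x = 0

/-! ### Besov ellipsoids of densities -/

/-- The coefficient `∫ f g_{jk}` of `f`. -/
def waveletCoeff (g f : ℝ → ℝ) (j k : ℤ) : ℝ := ∫ x, f x * dyadic g j k x

/-- The norm `J_{spq}(f) = ‖α_{0·}‖_p + ‖(2^{j(s + 1/2 - 1/p)} ‖β_{j·}‖_p)_{j ≥ 0}‖_q`, where
`‖·‖_p` and `‖·‖_q` are the norms of `ℓ^p(ℤ)` and `ℓ^q(ℕ)`; it may be infinite. -/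
def besovJ (φ ψ : ℝ → ℝ) (s : ℝ) (p q : ℝ≥0∞) (f : ℝ → ℝ) : ℝ≥0∞ :=
  eLpNorm (fun k : ℤ => waveletCoeff φ f 0 k) p Measure.count +
    eLpNorm (fun j : ℕ => (2 : ℝ≥0∞) ^ ((j : ℝ) * (s + 1 / 2 - (1 / p).toReal)) *
      eLpNorm (fun k : ℤ => waveletCoeff ψ f (j : ℤ) k) p Measure.count) q Measure.count

/-- The probability densities supported in `[-T, T]` that lie in the Besov ellipsoid of
radius `L`. -/
def densityClass (φ ψ : ℝ → ℝ) (s : ℝ) (p q : ℝ≥0∞) (L T : ℝ) : Set (ℝ → ℝ) :=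
  {f | (∀ x, 0 ≤ f x) ∧ Integrable f volume ∧ ∫ x, f x = 1 ∧
    Function.support f ⊆ Set.Icc (-T) T ∧ besovJ φ ψ s p q f ≤ ENNReal.ofReal L}

/-! ### Local differential privacy -/

/-- A (sequentially interactive) local `α`-differentially private mechanism with values in `Z`.
With indices starting at `0`, the kernel `Q i` is the conditional law of the `i`-th release given
the previous releases `z` and the `i`-th private observation `x`. Only the first `n` kernels
matter for `n` data holders. Non-interactive mechanisms are those with `Q i (z, x)` independent
of `i` and `z`. -/
structure PrivateMechanism (α : ℝ) (Z : Type*) [MeasurableSpace Z] where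
  Q : (i : ℕ) → Kernel ((Fin i → Z) × ℝ) Z
  markov : ∀ i, IsMarkovKernel (Q i)
  isPrivate : ∀ (i : ℕ) (z : Fin i → Z) (x x' : ℝ) (A : Set Z), MeasurableSet A →
    Q i (z, x) A ≤ ENNReal.ofReal (Real.exp α) * Q i (z, x') A

/-- The conditional law `Q^n(· | x_1, …, x_n)` of the private sample `(Z_1, …, Z_n)`, obtained by
successively applying the kernels of the mechanism. -/
def release {Z : Type*} [MeasurableSpace Z] (Q : (i : ℕ) → Kernel ((Fin i → Z) × ℝ) Z) :
    (n : ℕ) → Kernel (Fin n → ℝ) (Fin n → Z)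
  | 0 => Kernel.const _ (Measure.dirac Fin.elim0)
  | n + 1 =>
      (((release Q n).comap (fun (x : Fin (n + 1) → ℝ) (i : Fin n) => x i.castSucc)
          (by fun_prop)) ⊗ₖ
        ((Q n).comap (fun w : (Fin (n + 1) → ℝ) × (Fin n → Z) => (w.2, w.1 (Fin.last n)))
          (by fun_prop))).map
        (fun w : (Fin n → Z) × Z => (Fin.snoc w.1 w.2 : Fin (n + 1) → Z))

/-- The law of the private sample `(Z_1, …, Z_n)` when `X_1, …, X_n` are i.i.d. with
density `f`. -/
def privateLaw {Z : Type*} [MeasurableSpace Z] (Q : (i : ℕ) → Kernel ((Fin i → Z) × ℝ) Z)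
    (n : ℕ) (f : ℝ → ℝ) : Measure (Fin n → Z) :=
  (Measure.pi fun _ : Fin n => (volume : Measure ℝ).withDensity fun x => ENNReal.ofReal (f x)).bind
    (release Q n)

/-- Estimators of a density based on a private sample `(Z_1, …, Z_n)`. -/
def Estimator (n : ℕ) (Z : Type*) [MeasurableSpace Z] : Type _ :=
  {g : (Fin n → Z) → ℝ → ℝ // Measurable (Function.uncurry g)}

/-- The risk `E_{f,Q} ‖g - f‖_r^r`. -/
def risk {Z : Type*} [MeasurableSpace Z] (r : ℝ) (n : ℕ)
    (Q : (i : ℕ) → Kernel ((Fin i → Z) × ℝ) Z) (g : Estimator n Z) (f : ℝ → ℝ) : ℝ≥0∞ :=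
  ∫⁻ z, ∫⁻ x, ENNReal.ofReal (|g.1 z x - f x| ^ r) ∂volume ∂(privateLaw Q n f)

/-- The local `α`-private minimax `L^r`-risk over a class `F` of densities: the infimum is over
all measurable spaces `Z` of releases, all `α`-private mechanisms with values in `Z`, and all
estimators based on the private sample. -/
def privateMinimaxRisk (r : ℝ) (n : ℕ) (α : ℝ) (F : Set (ℝ → ℝ)) : ℝ≥0∞ :=
  ⨅ (Z : Type u) (_ : MeasurableSpace Z) (M : PrivateMechanism α Z) (g : Estimator n Z),
    ⨆ f ∈ F, risk r n M.Q g f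

end LDPBesov

end

/-! The bound comes from testing many sparse alternatives. Start from a density `f` in the interior
of the Besov ball that is bounded below on `[-T/2, T/2]`, and add a single wavelet `γ ψ_{jk}` with
`γ = c₁ 2^{-j(s+1/2-1/p)}`. By orthogonality the perturbation has Besov norm at most `c₁`. Its sup
norm is at most `c₁ B 2^{-j(s-1/p)}`, which stays below the lower bound of `f` because `s ≥ 1/p`;
its integral is zero. Letting `k` run over well separated positions gives a number of order `2^j` of
densities in the class whose perturbations have disjoint supports, so any two of them are at `L^r`
distance (to the power `r`) at least a constant times `2^{-j(r(s-1/p)+1)}`.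

Each alternative is at `L¹` distance `τ` of order `2^{-j(s-1/p+1)}` from `f`. A private release sees
this only through a likelihood ratio within `(e^α-1)τ` of `1` (`abs_real_bind_sub_le`). Conditioning
on the earlier releases and iterating, the likelihood ratio of `n` releases has second moment at
most `(1+((e^α-1)τ)²)^n` (`sq_lintegral_privateLaw_le`). If this is at most `2^{j/2}`, which is much
smaller than the number of alternatives, no test can identify the true one (`exists_real_le_half`),
and the separation becomes a lower bound for the risk (`le_privateMinimaxRisk`). The condition
allows `2^{j(2(s-1/p)+2)}` of order `m / log m` with `m = n(e^α-1)²` (`exists_level`), which is the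
stated rate.

The wavelet input is that `ψ` is bounded (`mother_ae_bounded`) and has vanishing moments up to order
`N` (`IsBoundedPair.moment_eq_zero`). The zeroth moment keeps the total mass equal to `1`; the
others give smooth bumps a finite Besov norm for `s < N+1`, so that the centre `f` can be built
(`IsBoundedPair.exists_center`). -/

namespace LDPBesov

/-! ### Dilations and translations -/

lemma quasiMeasurePreserving_affine (j k : ℤ) :
    Measure.QuasiMeasurePreserving (fun x : ℝ => (2 : ℝ) ^ j * x - (k : ℝ)) volume volume := by
  have h2 : (2 : ℝ) ^ j ≠ 0 := by positivity
  have h1 : Measure.QuasiMeasurePreserving (fun x : ℝ => (2 : ℝ) ^ j * x) volume volume :=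
    ⟨by fun_prop, by
      rw [Real.map_volume_mul_left h2]; exact Measure.smul_absolutelyContinuous⟩
  exact (measurePreserving_sub_right volume (k : ℝ)).quasiMeasurePreserving.comp h1

lemma dyadic_ae_congr {g g' : ℝ → ℝ} (h : g =ᵐ[volume] g') (j k : ℤ) :
    dyadic g j k =ᵐ[volume] dyadic g' j k := by
  filter_upwards [(quasiMeasurePreserving_affine j k).ae h] with x hx
  simp only [dyadic, hx]

lemma integral_affine (F : ℝ → ℝ) (j k : ℤ) :
    ∫ x, F ((2 : ℝ) ^ j * x - (k : ℝ)) = ((2 : ℝ) ^ j)⁻¹ * ∫ x, F x := by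
  have := Measure.integral_comp_mul_left (fun y => F (y - (k : ℝ))) ((2 : ℝ) ^ j)
  rw [this, integral_sub_right_eq_self, smul_eq_mul, abs_of_pos (by positivity)]

lemma integrable_affine {F : ℝ → ℝ} (hF : Integrable F) (j k : ℤ) :
    Integrable (fun x => F ((2 : ℝ) ^ j * x - (k : ℝ))) :=
  (hF.comp_sub_right (k : ℝ)).comp_mul_left' (by positivity)

lemma sqrt_dyadic_sq (j : ℤ) : ((2 : ℝ) ^ ((j : ℝ) / 2)) ^ 2 = (2 : ℝ) ^ j := by
  rw [← Real.rpow_natCast, ← Real.rpow_mul (by norm_num)]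
  simp

lemma dyadic_zero (g : ℝ → ℝ) (k : ℤ) (x : ℝ) : dyadic g 0 k x = g (x - k) := by
  simp [dyadic]

lemma memLp_dyadic {g : ℝ → ℝ} (hg : MemLp g 2 volume) (j k : ℤ) :
    MemLp (dyadic g j k) 2 volume := by
  have hm : AEStronglyMeasurable (fun x => g ((2 : ℝ) ^ j * x - (k : ℝ))) volume :=
    hg.1.comp_quasiMeasurePreserving (quasiMeasurePreserving_affine j k)
  have : MemLp (fun x => g ((2 : ℝ) ^ j * x - (k : ℝ))) 2 volume := by
    rw [memLp_two_iff_integrable_sq hm]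
    exact integrable_affine ((memLp_two_iff_integrable_sq hg.1).1 hg) j k
  exact this.const_mul _

lemma dyadic_add (g : ℝ → ℝ) (a j k : ℤ) (x : ℝ) :
    dyadic g (a + j) k x = (2 : ℝ) ^ ((j : ℝ) / 2) * dyadic g a k ((2 : ℝ) ^ j * x) := by
  simp only [dyadic]
  rw [zpow_add₀ (by norm_num : (2 : ℝ) ≠ 0), ← mul_assoc, ← mul_assoc, ← Real.rpow_add (by norm_num)]
  push_cast
  ring_nf

/-- Inner products are invariant under dilation. -/
lemma integral_dyadic_add (f g : ℝ → ℝ) (a b j k l : ℤ) :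
    ∫ x, dyadic f (a + j) k x * dyadic g (b + j) l x = ∫ x, dyadic f a k x * dyadic g b l x := by
  have h : ∀ x, dyadic f (a + j) k x * dyadic g (b + j) l x =
      (2 : ℝ) ^ j * (fun y => dyadic f a k y * dyadic g b l y) ((2 : ℝ) ^ j * x - ((0 : ℤ) : ℝ)) := by
    intro x
    rw [dyadic_add, dyadic_add, ← sqrt_dyadic_sq j]
    push_cast
    ring_nf
  simp_rw [h]
  rw [integral_const_mul, integral_affine (fun y => dyadic f a k y * dyadic g b l y), ← mul_assoc,
    mul_inv_cancel₀ (by positivity), one_mul]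

/-! ### Orthogonality relations -/

lemma mem_levelSpace {g : ℝ → ℝ} (hg : MemLp g 2 volume) (j k : ℤ) :
    (memLp_dyadic hg j k).toLp ∈ levelSpace g j :=
  Submodule.le_topologicalClosure _ (Submodule.subset_span ⟨k, MemLp.coeFn_toLp _⟩)

lemma inner_toLp_toLp {f g : ℝ → ℝ} (hf : MemLp f 2 volume) (hg : MemLp g 2 volume) :
    inner ℝ hf.toLp hg.toLp = ∫ x, f x * g x := by
  rw [L2.inner_def]
  refine integral_congr_ae ?_
  filter_upwards [hf.coeFn_toLp, hg.coeFn_toLp] with x h1 h2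
  simp [h1, h2, mul_comm]

/-- A vector orthogonal to all the generators is orthogonal to the level space. -/
lemma inner_eq_zero_of_mem_levelSpace {g : ℝ → ℝ} (hg : MemLp g 2 volume) {j : ℤ}
    {w : Lp ℝ 2 (volume : Measure ℝ)}
    (h : ∀ k, inner ℝ (memLp_dyadic hg j k).toLp w = 0) {u : Lp ℝ 2 (volume : Measure ℝ)}
    (hu : u ∈ levelSpace g j) : inner ℝ u w = 0 := by
  have hle : levelSpace g j ≤ (Submodule.span ℝ {w})ᗮ := by
    refine Submodule.topologicalClosure_minimal _ ?_ (Submodule.isClosed_orthogonal _)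
    rw [Submodule.span_le]
    rintro v ⟨k, hk⟩
    have : v = (memLp_dyadic hg j k).toLp := by
      apply Lp.ext
      exact hk.trans (MemLp.coeFn_toLp _).symm
    rw [SetLike.mem_coe, Submodule.mem_orthogonal_singleton_iff_inner_left, this]
    exact h k
  exact (Submodule.mem_orthogonal_singleton_iff_inner_left.1 (hle hu))

lemma levelSpace_mono {φ : ℝ → ℝ} (h : GeneratesMRA φ) {i j : ℤ} (hij : i ≤ j) :
    levelSpace φ i ≤ levelSpace φ j := by
  induction j, hij using Int.leInduction with
  | base => exact le_rfl
  | succ n _ ih => exact ih.trans (h.nested n)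

section

variable {φ ψ : ℝ → ℝ}

lemma integral_father_mother_same (hφ : GeneratesMRA φ) (hψ : IsMotherWavelet φ ψ)
    (j k l : ℤ) :
    ∫ x, dyadic φ j k x * dyadic ψ j l x = 0 := by
  have h := integral_dyadic_add φ ψ 0 0 j k l
  rw [zero_add] at h
  rw [h, ← inner_toLp_toLp (memLp_dyadic hφ.orthonormal.1 0 k) (memLp_dyadic hψ.orthonormal.1 0 l)]
  have := mem_levelSpace hψ.orthonormal.1 0 l
  rw [hψ.span_eq] at this
  exact (Submodule.mem_orthogonal _ _).1 this.1 _ (mem_levelSpace hφ.orthonormal.1 0 k)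

/-- The definition gives orthogonality to `V_0` at level `0` only; dilation carries it to level `j`.
All cross-level relations below follow from this by nestedness of the `V_j`. -/
lemma inner_mother_eq_zero (hφ : GeneratesMRA φ) (hψ : IsMotherWavelet φ ψ)
    {j l : ℤ} {u : Lp ℝ 2 (volume : Measure ℝ)}
    (hu : u ∈ levelSpace φ j) : inner ℝ u (memLp_dyadic hψ.orthonormal.1 j l).toLp = 0 := by
  refine inner_eq_zero_of_mem_levelSpace hφ.orthonormal.1 (fun k => ?_) hu
  rw [inner_toLp_toLp]
  exact integral_father_mother_same hφ hψ j k l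

lemma integral_father_mother (hφ : GeneratesMRA φ) (hψ : IsMotherWavelet φ ψ)
    (j : ℕ) (k l : ℤ) :
    ∫ x, dyadic φ 0 k x * dyadic ψ j l x = 0 := by
  rw [← inner_toLp_toLp (memLp_dyadic hφ.orthonormal.1 0 k) (memLp_dyadic hψ.orthonormal.1 j l)]
  exact inner_mother_eq_zero hφ hψ
    (levelSpace_mono hφ (by positivity) (mem_levelSpace hφ.orthonormal.1 0 k))

lemma integral_mother_mother_of_lt (hφ : GeneratesMRA φ) (hψ : IsMotherWavelet φ ψ)
    {i j : ℤ} (hij : i < j) (k l : ℤ) :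
    ∫ x, dyadic ψ i k x * dyadic ψ j l x = 0 := by
  have h := integral_dyadic_add ψ ψ 0 (j - i) i k l
  rw [zero_add, sub_add_cancel] at h
  rw [h, ← inner_toLp_toLp (memLp_dyadic hψ.orthonormal.1 0 k) (memLp_dyadic hψ.orthonormal.1 _ l)]
  have := mem_levelSpace hψ.orthonormal.1 0 k
  rw [hψ.span_eq] at this
  exact inner_mother_eq_zero hφ hψ (levelSpace_mono hφ (by omega) this.2)

lemma integral_mother_mother (hφ : GeneratesMRA φ) (hψ : IsMotherWavelet φ ψ)
    (i j k l : ℤ) :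
    ∫ x, dyadic ψ i k x * dyadic ψ j l x = if i = j ∧ k = l then 1 else 0 := by
  rcases lt_trichotomy i j with h | rfl | h
  · rw [integral_mother_mother_of_lt hφ hψ h, if_neg (by omega)]
  · have h := integral_dyadic_add ψ ψ 0 0 i k l
    rw [zero_add] at h
    rw [h, hψ.orthonormal.2 k l]
    simp
  · simp_rw [mul_comm (dyadic ψ i k _)]
    rw [integral_mother_mother_of_lt hφ hψ h, if_neg (by omega)]

/-- A compactly supported mother wavelet is a finite combination of the `φ_{1k}`. -/
lemma mother_ae_bounded (hφ : GeneratesMRA φ) (hψ : IsMotherWavelet φ ψ)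
    {A B : ℝ} (hA : ∀ x, A < |x| → φ x = 0 ∧ ψ x = 0)
    (hB : ∀ x, |φ x| ≤ B) : ∃ B' : ℝ, ∀ᵐ x ∂(volume : Measure ℝ), |ψ x| ≤ B' := by
  have hB0 : 0 ≤ B := (abs_nonneg _).trans (hB 0)
  -- `ψ` lives on `|x| ≤ A` and `φ_{1k}` on `|2x - k| ≤ A`, so their supports meet only if `|k| ≤
  -- 3A`.
  obtain ⟨K, hK⟩ := exists_nat_gt (3 * |A|)
  set c : ℤ → ℝ := fun k => ∫ x, dyadic φ 1 k x * ψ x with hc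
  have hc0 : ∀ k : ℤ, k ∉ Finset.Icc (-(K : ℤ)) K → c k = 0 := by
    intro k hk
    have hk' : (K : ℝ) < |(k : ℝ)| := by
      have : (K : ℤ) < |k| := by
        rw [Finset.mem_Icc, ← abs_le] at hk; omega
      exact_mod_cast this
    have : ∀ x, dyadic φ 1 k x * ψ x = 0 := by
      intro x
      by_cases hx : A < |x|
      · rw [(hA x hx).2, mul_zero]
      · have : A < |(2 : ℝ) ^ (1 : ℤ) * x - k| := by
          push Not at hx
          have h1 := abs_sub_abs_le_abs_sub (k : ℝ) (2 * x)
          rw [abs_sub_comm, abs_mul, abs_two] at h1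
          have := le_abs_self A
          rw [zpow_one]
          linarith
        rw [dyadic, (hA _ this).1, mul_zero, zero_mul]
    simp [hc, this]
  have hφ2 := hφ.orthonormal.1
  have hψ2 := hψ.orthonormal.1
  set u : Lp ℝ 2 (volume : Measure ℝ) := hψ2.toLp with hu
  have hu1 : u ∈ levelSpace φ 1 := by
    have := mem_levelSpace hψ2 0 0
    rw [hψ.span_eq] at this
    have e : (memLp_dyadic hψ2 0 0).toLp = u := by
      rw [hu]
      exact MemLp.toLp_congr _ _ (Filter.Eventually.of_forall fun x => by simp [dyadic])
    rw [e] at this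
    exact this.2
  -- The residual lies in `V_1` and is orthogonal to all its generators, hence is zero. So the
  -- finite sum is exact and no convergence of a series is involved.
  set v : Lp ℝ 2 (volume : Measure ℝ) :=
    u - ∑ k ∈ Finset.Icc (-(K : ℤ)) K, c k • (memLp_dyadic hφ2 1 k).toLp with hv
  have hv1 : v ∈ levelSpace φ 1 :=
    Submodule.sub_mem _ hu1 (Submodule.sum_mem _ fun k _ =>
      Submodule.smul_mem _ _ (mem_levelSpace hφ2 1 k))
  have horth : ∀ l, inner ℝ (memLp_dyadic hφ2 1 l).toLp v = 0 := by
    intro l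
    have hφφ : ∀ k, inner ℝ (memLp_dyadic hφ2 1 l).toLp (memLp_dyadic hφ2 1 k).toLp =
        if l = k then (1 : ℝ) else 0 := by
      intro k
      rw [inner_toLp_toLp]
      have h := integral_dyadic_add φ φ 0 0 1 l k
      rw [zero_add] at h
      rw [h, hφ.orthonormal.2]
    rw [hv, inner_sub_right, inner_sum]
    simp_rw [inner_smul_right, hφφ]
    rw [hu, inner_toLp_toLp]
    by_cases hl : l ∈ Finset.Icc (-(K : ℤ)) K
    · simp only [mul_ite, mul_one, mul_zero, Finset.sum_ite_eq, hl, if_true]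
      simp [hc]
    · have := hc0 l hl
      simp only [mul_ite, mul_one, mul_zero, Finset.sum_ite_eq, hl, if_false, sub_zero]
      exact this
  have hv0 : v = 0 := by
    have := inner_eq_zero_of_mem_levelSpace hφ2 horth hv1
    exact inner_self_eq_zero.1 this
  have hsum : u = ∑ k ∈ Finset.Icc (-(K : ℤ)) K, c k • (memLp_dyadic hφ2 1 k).toLp :=
    sub_eq_zero.1 hv0
  have hae : ψ =ᵐ[volume] fun x => ∑ k ∈ Finset.Icc (-(K : ℤ)) K, c k * dyadic φ 1 k x := by
    have h1 : ψ =ᵐ[volume] u := hψ2.coeFn_toLp.symm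
    rw [hsum] at h1
    refine h1.trans ?_
    refine (Lp.coeFn_finsetSum _ _).trans ?_
    have : ∀ᵐ x ∂(volume : Measure ℝ), ∀ k : ℤ,
        (c k • (memLp_dyadic hφ2 1 k).toLp : Lp ℝ 2 (volume : Measure ℝ)) x = c k * dyadic φ 1 k x := by
      rw [ae_all_iff]
      intro k
      filter_upwards [Lp.coeFn_smul (c k) (memLp_dyadic hφ2 1 k).toLp,
        (memLp_dyadic hφ2 1 k).coeFn_toLp] with x h2 h3
      rw [h2, Pi.smul_apply, h3, smul_eq_mul]
    filter_upwards [this] with x hx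
    simp [Finset.sum_apply, hx]
  refine ⟨∑ k ∈ Finset.Icc (-(K : ℤ)) K, |c k| * ((2 : ℝ) ^ (((1 : ℤ) : ℝ) / 2) * B), ?_⟩
  filter_upwards [hae] with x hx
  rw [hx]
  refine (Finset.abs_sum_le_sum_abs _ _).trans (Finset.sum_le_sum fun k _ => ?_)
  rw [abs_mul, dyadic, abs_mul, abs_of_pos (by positivity : (0 : ℝ) < 2 ^ (((1 : ℤ) : ℝ) / 2))]
  gcongr
  exact hB _

end

/-! ### Everywhere bounded representatives -/

/-- The properties of a wavelet pair, with everywhere bounded and measurable representatives, that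
are used below. -/
structure IsBoundedPair (N : ℕ) (φ ψ : ℝ → ℝ) (A B : ℝ) : Prop where
  pos : 0 < A
  measurable_father : Measurable φ
  measurable_mother : Measurable ψ
  father_le : ∀ x, |φ x| ≤ B
  mother_le : ∀ x, |ψ x| ≤ B
  father_zero : ∀ x, A < |x| → φ x = 0
  mother_zero : ∀ x, A < |x| → ψ x = 0
  father_norm : ∫ x, φ x * φ x = 1
  father_mother : ∀ (j : ℕ) (k l : ℤ), ∫ x, dyadic φ 0 k x * dyadic ψ j l x = 0
  mother_mother : ∀ i j k l : ℤ,
    ∫ x, dyadic ψ i k x * dyadic ψ j l x = if i = j ∧ k = l then 1 else 0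
  weakDeriv : ∃ g : ℝ → ℝ, IsWeakDeriv (N + 1) φ g ∧
    ∃ D : ℝ, ∀ᵐ x ∂(volume : Measure ℝ), |g x| ≤ D

/-- Bounds holding everywhere are wanted because a density of the class must be nonnegative at every
point and vanish at every point outside `[-T, T]`, also after a wavelet is added. -/
lemma exists_bounded_representative {g : ℝ → ℝ} (hg : AEStronglyMeasurable g volume) {A B : ℝ}
    (hB0 : 0 ≤ B) (hA : ∀ x, A < |x| → g x = 0)
    (hB : ∀ᵐ x ∂(volume : Measure ℝ), |g x| ≤ B) :
    ∃ g' : ℝ → ℝ, Measurable g' ∧ (∀ x, |g' x| ≤ B) ∧ (∀ x, A < |x| → g' x = 0) ∧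
      g =ᵐ[volume] g' := by
  have hm : Measurable (hg.mk g) := hg.stronglyMeasurable_mk.measurable
  refine ⟨Set.indicator {x | |x| ≤ A ∧ |hg.mk g x| ≤ B} (hg.mk g), ?_, fun x => ?_, fun x hx => ?_, ?_⟩
  · exact hm.indicator ((measurableSet_le (f := fun x : ℝ => |x|) (by fun_prop)
      measurable_const).inter (measurableSet_le (f := fun x => |hg.mk g x|) (by fun_prop)
      measurable_const))
  · by_cases hx : x ∈ {x | |x| ≤ A ∧ |hg.mk g x| ≤ B}
    · rw [Set.indicator_of_mem hx]; exact hx.2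
    · rw [Set.indicator_of_notMem hx]; simpa using hB0
  · exact Set.indicator_of_notMem (fun h => absurd h.1 (not_le.2 hx)) _
  · filter_upwards [hB, hg.ae_eq_mk] with x h1 h2
    by_cases hx : |x| ≤ A
    · have hmem : x ∈ {x | |x| ≤ A ∧ |hg.mk g x| ≤ B} := ⟨hx, h2 ▸ h1⟩
      rw [Set.indicator_of_mem hmem, h2]
    · rw [Set.indicator_of_notMem (fun h => hx h.1), hA x (not_le.1 hx)]

lemma IsWaveletPair.exists_isBoundedPair {N : ℕ} {φ ψ : ℝ → ℝ} (h : IsWaveletPair N φ ψ) :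
    ∃ (φ' ψ' : ℝ → ℝ) (A B : ℝ), IsBoundedPair N φ' ψ' A B ∧ φ =ᵐ[volume] φ' ∧
      ψ =ᵐ[volume] ψ' := by
  obtain ⟨A₀, hA₀⟩ := h.compact
  obtain ⟨Φ, -, ⟨B₁, hB₁⟩, hΦ, -⟩ := h.regular.decay
  have hφB : ∀ x, |φ x| ≤ B₁ := fun x =>
    (hΦ x).trans ((le_abs_self _).trans (hB₁ _ (abs_nonneg _)))
  obtain ⟨B₂, hψB⟩ := mother_ae_bounded h.mra h.mother hA₀ hφB
  set A := max A₀ 1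
  set B := max B₁ (max B₂ 0)
  have hA : ∀ x, A < |x| → φ x = 0 ∧ ψ x = 0 := fun x hx => hA₀ x ((le_max_left _ _).trans_lt hx)
  have hB0 : 0 ≤ B := (le_max_right _ _).trans (le_max_right _ _)
  obtain ⟨φ', hφm, hφb, hφ0, hφe⟩ := exists_bounded_representative h.mra.orthonormal.1.1 hB0
    (fun x hx => (hA x hx).1)
    (Filter.Eventually.of_forall fun x => (hφB x).trans (le_max_left _ _))
  obtain ⟨ψ', hψm, hψb, hψ0, hψe⟩ := exists_bounded_representative h.mother.orthonormal.1.1 hB0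
    (fun x hx => (hA x hx).2)
    (hψB.mono fun x hx => hx.trans ((le_max_left _ _).trans (le_max_right _ _)))
  refine ⟨φ', ψ', A, B, ⟨lt_max_of_lt_right one_pos, hφm, hψm, hφb, hψb, hφ0, hψ0, ?_, ?_, ?_, ?_⟩,
    hφe, hψe⟩
  · have h1 := h.mra.orthonormal.2 0 0
    rw [if_pos rfl] at h1
    rw [← h1]
    refine integral_congr_ae ?_
    filter_upwards [hφe] with x hx
    simp [dyadic, hx]
  · intro j k l
    rw [← integral_father_mother h.mra h.mother j k l]
    refine integral_congr_ae ?_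
    filter_upwards [dyadic_ae_congr hφe 0 k, dyadic_ae_congr hψe j l] with x h1 h2
    rw [h1, h2]
  · intro i j k l
    rw [← integral_mother_mother h.mra h.mother i j k l]
    refine integral_congr_ae ?_
    filter_upwards [dyadic_ae_congr hψe i k, dyadic_ae_congr hψe j l] with x h1 h2
    rw [h1, h2]
  · obtain ⟨g, ⟨hl, hg, hw⟩, D, hD⟩ := h.regular.weakDeriv
    refine ⟨g, ⟨hl.congr hφe, hg, fun θ h1 h2 => ?_⟩, max D 0, ?_⟩
    · rw [← hw θ h1 h2]
      refine integral_congr_ae ?_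
      filter_upwards [hφe] with x hx
      rw [hx]
    -- The term `k = 0` of the periodised sum already bounds `g`. The maximum with `0` covers a
    -- negative `D`, for which `ENNReal.ofReal D` is `0`.
    · filter_upwards [hD] with x hx
      have h1 : ‖g x‖ₑ ≤ ENNReal.ofReal D := by
        refine le_trans ?_ hx
        simpa using ENNReal.le_tsum (f := fun k : ℤ => ‖g (x - (k : ℝ))‖ₑ) 0
      rw [← ofReal_norm, Real.norm_eq_abs] at h1
      rcases le_total 0 D with h0 | h0
      · exact ((ENNReal.ofReal_le_ofReal_iff h0).1 h1).trans (le_max_left _ _)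
      · rw [ENNReal.ofReal_of_nonpos h0, nonpos_iff_eq_zero, ENNReal.ofReal_eq_zero] at h1
        exact h1.trans (le_max_right _ _)

lemma waveletCoeff_congr {g g' : ℝ → ℝ} (h : g =ᵐ[volume] g') (f : ℝ → ℝ) (j k : ℤ) :
    waveletCoeff g f j k = waveletCoeff g' f j k := by
  refine integral_congr_ae ?_
  filter_upwards [dyadic_ae_congr h j k] with x hx
  rw [hx]

lemma besovJ_congr {φ φ' ψ ψ' : ℝ → ℝ} (hφ : φ =ᵐ[volume] φ') (hψ : ψ =ᵐ[volume] ψ') :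
    besovJ φ ψ = besovJ φ' ψ' := by
  funext s p q f
  simp only [besovJ, waveletCoeff_congr hφ, waveletCoeff_congr hψ]

lemma densityClass_congr {φ φ' ψ ψ' : ℝ → ℝ} (hφ : φ =ᵐ[volume] φ') (hψ : ψ =ᵐ[volume] ψ') :
    densityClass φ ψ = densityClass φ' ψ' := by
  funext s p q L T
  simp only [densityClass, besovJ_congr hφ hψ]

/-! ### Smooth functions with compact support -/

lemma integrable_of_bounded_of_support {g : ℝ → ℝ} (hm : Measurable g) {A B : ℝ}
    (hB : ∀ x, |g x| ≤ B) (hA : ∀ x, A < |x| → g x = 0) : Integrable g := by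
  rw [← integrableOn_iff_integrable_of_support_subset (s := Set.Icc (-A) A)]
  · exact Measure.integrableOn_of_bounded (M := B) (by simp) hm.aestronglyMeasurable
      (Filter.Eventually.of_forall hB)
  · intro x hx
    by_contra h
    refine hx (hA x ?_)
    rw [Set.mem_Icc, ← abs_le] at h
    exact not_le.1 h

lemma integrable_continuous_mul {g : ℝ → ℝ} (hm : Measurable g) {A B : ℝ}
    (hB : ∀ x, |g x| ≤ B) (hA : ∀ x, A < |x| → g x = 0) {G : ℝ → ℝ} (hG : Continuous G) :
    Integrable (fun x => G x * g x) := by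
  rw [← integrableOn_iff_integrable_of_support_subset (s := Set.Icc (-A) A)]
  · exact (integrable_of_bounded_of_support hm hB hA).integrableOn.continuousOn_mul
      hG.continuousOn isCompact_Icc
  · intro x hx
    by_contra h
    refine hx ?_
    rw [Set.mem_Icc, ← abs_le] at h
    simp only [hA x (not_le.1 h), mul_zero]

/-- Mean value inequality starting from the point `-R - 1`, where `G` vanishes. Iterated, it
controls all lower derivatives of a compactly supported function by a higher one. -/
lemma abs_le_of_abs_deriv_le {G : ℝ → ℝ} (hG : Differentiable ℝ G) {R D : ℝ} (hR : 0 ≤ R)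
    (h0 : ∀ x, R < |x| → G x = 0) (hD : ∀ x, |deriv G x| ≤ D) (x : ℝ) :
    |G x| ≤ D * (2 * R + 2) := by
  have hD0 : 0 ≤ D := (abs_nonneg _).trans (hD 0)
  by_cases hx : R < |x|
  · rw [h0 x hx, abs_zero]; positivity
  · have h1 := Convex.norm_image_sub_le_of_norm_deriv_le (f := G) (C := D) (s := Set.univ)
      (fun y _ => hG y) (fun y _ => hD y) convex_univ (Set.mem_univ (-R - 1)) (Set.mem_univ x)
    have h2 : G (-R - 1) = 0 := h0 _ (by rw [abs_of_neg (by linarith)]; linarith)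
    rw [h2, sub_zero, Real.norm_eq_abs, Real.norm_eq_abs] at h1
    refine h1.trans ?_
    have := abs_le.1 (not_lt.1 hx)
    gcongr
    rw [abs_le]
    constructor <;> linarith

lemma iteratedDeriv_eq_zero_of_support {G : ℝ → ℝ} {R : ℝ} (h0 : ∀ x, R < |x| → G x = 0) (n : ℕ)
    {x : ℝ} (hx : R < |x|) : iteratedDeriv n G x = 0 := by
  have ho : IsOpen {x : ℝ | R < |x|} := isOpen_lt continuous_const continuous_abs
  have := Set.EqOn.iteratedDeriv_of_isOpen (f := G) (g := fun _ => (0 : ℝ)) (fun y hy => h0 y hy)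
    ho n hx
  rw [this, iteratedDeriv_const]
  simp

lemma abs_iteratedDeriv_le_of_top {G : ℝ → ℝ} (hG : ContDiff ℝ (⊤ : ℕ∞) G) {R D : ℝ} (hR : 0 ≤ R)
    (h0 : ∀ x, R < |x| → G x = 0) (i k : ℕ) (hD : ∀ x, |iteratedDeriv (i + k) G x| ≤ D) (x : ℝ) :
    |iteratedDeriv i G x| ≤ D * (2 * R + 2) ^ k := by
  induction k generalizing i x with
  | zero => simpa using hD x
  | succ k ih =>
    have h1 : ∀ x, |deriv (iteratedDeriv i G) x| ≤ D * (2 * R + 2) ^ k := by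
      intro x
      rw [← iteratedDeriv_succ]
      refine ih (i + 1) (fun y => ?_) x
      rw [show i + 1 + k = i + (k + 1) by ring]
      exact hD y
    have h2 := abs_le_of_abs_deriv_le (G := iteratedDeriv i G)
      (hG.differentiable_iteratedDeriv i (by exact_mod_cast WithTop.coe_lt_top i)) hR
      (fun x hx => iteratedDeriv_eq_zero_of_support h0 i hx) h1 x
    rwa [pow_succ, ← mul_assoc]

lemma abs_sub_taylor_le {F : ℝ → ℝ} (hF : ContDiff ℝ (⊤ : ℕ∞) F) {m : ℕ} {D : ℝ}
    (hD : ∀ x, |iteratedDeriv (m + 1) F x| ≤ D) (t u : ℝ) :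
    |F (t + u) - ∑ i ∈ Finset.range (m + 1), iteratedDeriv i F t * u ^ i / i.factorial| ≤
      D * |u| ^ (m + 1) := by
  have hD0 : 0 ≤ D := (abs_nonneg _).trans (hD 0)
  by_cases hu : u = 0
  · subst hu
    rw [Finset.sum_range_succ']
    simp
  have hne : t ≠ t + u := by simpa using hu
  obtain ⟨z, -, h⟩ := taylor_mean_remainder_lagrange_iteratedDeriv (n := m) hne
    ((hF.of_le (by exact_mod_cast le_top)).contDiffOn)
  have hT : taylorWithinEval F m (Set.uIcc t (t + u)) t (t + u) =
      ∑ i ∈ Finset.range (m + 1), iteratedDeriv i F t * u ^ i / i.factorial := by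
    rw [taylor_within_apply]
    refine Finset.sum_congr rfl fun i _ => ?_
    rw [iteratedDerivWithin_eq_iteratedDeriv (uniqueDiffOn_uIcc hne)
      ((hF.of_le (by exact_mod_cast le_top)).contDiffAt) Set.left_mem_uIcc]
    simp only [add_sub_cancel_left, smul_eq_mul]
    field_simp
  rw [hT] at h
  rw [h, add_sub_cancel_left, abs_div, abs_mul, abs_pow]
  have hfac : (1 : ℝ) ≤ |((m + 1).factorial : ℝ)| := by
    rw [Nat.abs_cast]; exact_mod_cast Nat.succ_le_of_lt (Nat.factorial_pos _)
  exact (div_le_self (by positivity) hfac).trans (by gcongr; exact hD z)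

/-- Taylor expansion of the integral of a smooth function against a dilated function whose moments
of order less than `m` vanish. -/
lemma abs_integral_sub_moment_le {F ψ : ℝ → ℝ} (hF : ContDiff ℝ (⊤ : ℕ∞) F) {m : ℕ} {D : ℝ}
    (hD : ∀ x, |iteratedDeriv (m + 1) F x| ≤ D) (hm : Measurable ψ) {A B : ℝ}
    (hB : ∀ x, |ψ x| ≤ B) (hA : ∀ x, A < |x| → ψ x = 0)
    (hmom : ∀ i < m, ∫ y, y ^ i * ψ y = 0) (t : ℝ) {δ : ℝ} (hδ : 0 ≤ δ) :
    |(∫ y, F (t + δ * y) * ψ y) -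
        iteratedDeriv m F t * δ ^ m / m.factorial * ∫ y, y ^ m * ψ y| ≤
      D * δ ^ (m + 1) * ∫ y, |y| ^ (m + 1) * |ψ y| := by
  have hint : ∀ {G : ℝ → ℝ}, Continuous G → Integrable (fun x => G x * ψ x) := fun hG =>
    integrable_continuous_mul hm hB hA hG
  have hF0 : Continuous F := hF.continuous
  have hsum : ∫ y, (∑ i ∈ Finset.range (m + 1), iteratedDeriv i F t * (δ * y) ^ i / i.factorial) *
      ψ y = iteratedDeriv m F t * δ ^ m / m.factorial * ∫ y, y ^ m * ψ y := by
    have h1 : ∀ y, (∑ i ∈ Finset.range (m + 1), iteratedDeriv i F t * (δ * y) ^ i / i.factorial) *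
        ψ y = ∑ i ∈ Finset.range (m + 1),
          (iteratedDeriv i F t * δ ^ i / i.factorial) * (y ^ i * ψ y) := by
      intro y
      rw [Finset.sum_mul]
      refine Finset.sum_congr rfl fun i _ => ?_
      rw [mul_pow]; ring
    simp_rw [h1]
    rw [integral_finsetSum _ fun i _ => (hint (by fun_prop)).const_mul _]
    simp_rw [integral_const_mul]
    rw [Finset.sum_range_succ, Finset.sum_eq_zero, zero_add]
    intro i hi
    rw [hmom i (Finset.mem_range.1 hi), mul_zero]
  rw [← hsum, ← integral_sub (hint (by fun_prop)) (hint (by fun_prop)), ← integral_const_mul]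
  refine (abs_integral_le_integral_abs).trans (integral_mono ?_ ?_ ?_)
  · exact ((hint (by fun_prop)).sub (hint (by fun_prop))).abs
  · refine Integrable.const_mul ?_ _
    have := (hint (G := fun y => |y| ^ (m + 1)) (by fun_prop)).abs
    refine this.congr (Filter.Eventually.of_forall fun y => ?_)
    simp [abs_mul]
  · intro y
    dsimp only
    rw [← sub_mul, abs_mul]
    have := abs_sub_taylor_le hF hD t (δ * y)
    rw [abs_mul, abs_of_nonneg hδ, mul_pow] at this
    calc _ ≤ D * (δ ^ (m + 1) * |y| ^ (m + 1)) * |ψ y| := by gcongr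
      _ = _ := by ring

/-! ### Mollification -/

open scoped Convolution in
lemma iteratedDeriv_convolution {ρ φ : ℝ → ℝ} (hρ : ContDiff ℝ (⊤ : ℕ∞) ρ)
    (hρc : HasCompactSupport ρ) (hφ : LocallyIntegrable φ volume) (n : ℕ) :
    iteratedDeriv n (ρ ⋆[ContinuousLinearMap.lsmul ℝ ℝ, volume] φ) =
      (iteratedDeriv n ρ) ⋆[ContinuousLinearMap.lsmul ℝ ℝ, volume] φ := by
  induction n generalizing ρ with
  | zero => simp
  | succ n ih =>
    rw [iteratedDeriv_succ', iteratedDeriv_succ', ← ih (contDiff_infty_iff_deriv.1 hρ).2 hρc.deriv]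
    congr 1
    funext x
    exact (hρc.hasDerivAt_convolution_left _ (hρ.of_le (by exact_mod_cast le_top)) hφ x).deriv

open scoped Convolution in
-- Averaging against a probability density preserves sup bounds. This applies to `φ` and also to
-- `g`, since derivatives of the convolution fall on `ρ` and the weak derivative moves them to `g`:
-- the mollified `φ` has as its `M`th derivative the mollified `g`.
lemma mollification_bounds {ρ φ g : ℝ → ℝ} {M : ℕ} {A B D : ℝ} (hρ : ContDiff ℝ (⊤ : ℕ∞) ρ)
    (hρ0 : ∀ x, 0 ≤ ρ x) (hρ1 : ∫ x, ρ x = 1) (hρs : ∀ x, 1 < |x| → ρ x = 0)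
    (hφB : ∀ x, |φ x| ≤ B) (hφA : ∀ x, A < |x| → φ x = 0)
    (hg : IsWeakDeriv M φ g) (hD : ∀ᵐ x ∂(volume : Measure ℝ), |g x| ≤ D) :
    let F := ρ ⋆[ContinuousLinearMap.lsmul ℝ ℝ, volume] φ
    ContDiff ℝ (⊤ : ℕ∞) F ∧ (∀ x, |F x| ≤ B) ∧ (∀ x, A + 1 < |x| → F x = 0) ∧
      ∀ x, |iteratedDeriv M F x| ≤ D := by
  intro F
  have hρc : HasCompactSupport ρ := HasCompactSupport.of_support_subset_isCompact
    (isCompact_Icc (a := -1) (b := 1)) (fun x hx => by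
      by_contra h
      rw [Set.mem_Icc, ← abs_le] at h
      exact hx (hρs x (not_le.1 h)))
  have hρi : Integrable ρ := hρ.continuous.integrable_of_hasCompactSupport hρc
  have hFx : ∀ x, F x = ∫ t, ρ t * φ (x - t) := fun x => by
    simp [F, convolution_def]
  refine ⟨hρc.contDiff_convolution_left _ hρ hg.1, fun x => ?_, fun x hx => ?_, fun x => ?_⟩
  · rw [hFx, ← one_mul B, ← hρ1, ← integral_mul_const]
    refine abs_integral_le_integral_abs.trans (integral_mono_of_nonneg
      (Filter.Eventually.of_forall fun _ => abs_nonneg _) (hρi.mul_const _)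
      (Filter.Eventually.of_forall fun t => ?_))
    dsimp only
    rw [abs_mul, abs_of_nonneg (hρ0 t)]
    exact mul_le_mul_of_nonneg_left (hφB _) (hρ0 t)
  · rw [hFx]
    refine integral_eq_zero_of_ae (Filter.Eventually.of_forall fun t => ?_)
    by_cases ht : 1 < |t|
    · simp [hρs t ht]
    · have h1 := abs_sub_abs_le_abs_sub x t
      have : φ (x - t) = 0 := hφA _ (by linarith)
      simp [this]
  · have h1 : iteratedDeriv M F x = ∫ t, g t * ρ (x - t) := by
      have h2 := hg.2.2 (fun t => ρ (x - t)) (hρ.comp (contDiff_const.sub contDiff_id))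
        (hρc.comp_homeomorph (Homeomorph.subLeft x))
      rw [iteratedDeriv_convolution hρ hρc hg.1, convolution_eq_swap]
      simp only [ContinuousLinearMap.lsmul_apply, smul_eq_mul]
      -- Reflecting the argument of `ρ` produces a sign `(-1)^M`, which cancels the sign in the
      -- definition of the weak derivative.
      rw [iteratedDeriv_comp_const_sub] at h2
      have h3 : ∀ t, φ t * (-1 : ℝ) ^ M • iteratedDeriv M ρ (x - t) =
          (-1) ^ M * (iteratedDeriv M ρ (x - t) * φ t) := fun t => by
        rw [smul_eq_mul]; ring
      simp_rw [h3] at h2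
      rw [integral_const_mul] at h2
      exact mul_left_cancel₀ (pow_ne_zero _ (by norm_num)) h2
    have hi : Integrable (fun t => ρ (x - t)) := hρi.comp_sub_left x
    rw [h1, ← mul_one D, ← hρ1, ← integral_sub_left_eq_self ρ volume x, ← integral_const_mul]
    refine abs_integral_le_integral_abs.trans (integral_mono_of_nonneg
      (Filter.Eventually.of_forall fun _ => abs_nonneg _) (hi.const_mul _) ?_)
    filter_upwards [hD] with t ht
    rw [abs_mul, abs_of_nonneg (hρ0 _)]
    exact mul_le_mul_of_nonneg_right ht (hρ0 _)

/-- A bounded function with compact support and a bounded weak derivative of order `M` is the limit,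
almost everywhere and in `L¹`, of uniformly bounded smooth functions with bounded derivatives. -/
lemma exists_smooth_approximation {φ g : ℝ → ℝ} {M : ℕ} {A B D : ℝ}
    (hφm : Measurable φ) (hφB : ∀ x, |φ x| ≤ B) (hφA : ∀ x, A < |x| → φ x = 0)
    (hg : IsWeakDeriv M φ g) (hD : ∀ᵐ x ∂(volume : Measure ℝ), |g x| ≤ D) :
    ∃ F : ℕ → ℝ → ℝ, (∀ i, ContDiff ℝ (⊤ : ℕ∞) (F i) ∧ (∀ x, |F i x| ≤ B) ∧
      (∀ x, A + 1 < |x| → F i x = 0) ∧ ∀ x, |iteratedDeriv M (F i) x| ≤ D) ∧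
      (∀ᵐ x ∂(volume : Measure ℝ), Filter.Tendsto (fun i => F i x) Filter.atTop (nhds (φ x))) ∧
      Filter.Tendsto (fun i => ∫ x, |F i x - φ x|) Filter.atTop (nhds 0) := by
  let b : ℕ → ContDiffBump (0 : ℝ) := fun i =>
    { rIn := 1 / (2 * ((i : ℝ) + 1))
      rOut := 1 / ((i : ℝ) + 1)
      rIn_pos := by positivity
      rIn_lt_rOut := by
        have : (0 : ℝ) < (i : ℝ) + 1 := by positivity
        gcongr; linarith }
  let F : ℕ → ℝ → ℝ := fun i =>
    MeasureTheory.convolution ((b i).normed volume) φ (ContinuousLinearMap.lsmul ℝ ℝ) volume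
  have hF : ∀ i, ContDiff ℝ (⊤ : ℕ∞) (F i) ∧ (∀ x, |F i x| ≤ B) ∧
      (∀ x, A + 1 < |x| → F i x = 0) ∧ ∀ x, |iteratedDeriv M (F i) x| ≤ D := by
    intro i
    refine mollification_bounds (b i).contDiff_normed (b i).nonneg_normed (b i).integral_normed
      (fun x hx => ?_) hφB hφA hg hD
    rw [← Function.notMem_support, (b i).support_normed_eq, Metric.mem_ball, dist_zero_right, not_lt]
    refine le_trans ?_ hx.le
    have : (1 : ℝ) ≤ (i : ℝ) + 1 := by simp
    exact div_le_one_of_le₀ this (by positivity)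
  have hlim : ∀ᵐ x ∂(volume : Measure ℝ),
      Filter.Tendsto (fun i => F i x) Filter.atTop (nhds (φ x)) := by
    -- Almost everywhere convergence needs bumps whose outer radius is at most a fixed multiple of
    -- the inner one; the ratio here is exactly `2`.
    refine ContDiffBump.ae_convolution_tendsto_right_of_locallyIntegrable (K := 2) ?_ ?_ hg.1
    · exact tendsto_one_div_add_atTop_nhds_zero_nat
    · refine Filter.Eventually.of_forall fun i => ?_
      change 1 / ((i : ℝ) + 1) ≤ 2 * (1 / (2 * ((i : ℝ) + 1)))
      apply le_of_eq
      field_simp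
  refine ⟨F, hF, hlim, ?_⟩
  have h0 : ∫ _ : ℝ, (0 : ℝ) = 0 := by simp
  rw [← h0]
  have hB0 : 0 ≤ B := (abs_nonneg _).trans (hφB 0)
  refine tendsto_integral_of_dominated_convergence
    (Set.indicator (Set.Icc (-(A + 1)) (A + 1)) fun _ => 2 * B) ?_ ?_ ?_ ?_
  · intro i
    exact (((hF i).1.continuous.measurable.sub hφm).abs).aestronglyMeasurable
  · rw [integrable_indicator_iff measurableSet_Icc]
    exact continuous_const.integrableOn_Icc
  · refine fun i => Filter.Eventually.of_forall fun x => ?_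
    rw [Real.norm_eq_abs, abs_abs]
    by_cases hx : x ∈ Set.Icc (-(A + 1)) (A + 1)
    · rw [Set.indicator_of_mem hx, two_mul]
      exact (abs_sub _ _).trans (add_le_add ((hF i).2.1 x) (hφB x))
    · rw [Set.indicator_of_notMem hx]
      rw [Set.mem_Icc, ← abs_le, not_le] at hx
      rw [(hF i).2.2.1 x hx, hφA x (by linarith)]
      simp
  · filter_upwards [hlim] with x hx
    have := (hx.sub_const (φ x)).abs
    simpa using this

/-! ### Vanishing moments of the mother wavelet -/

lemma integral_mul_dyadic (F g : ℝ → ℝ) (j k : ℤ) :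
    ∫ x, F x * dyadic g j k x = ((2 : ℝ) ^ ((j : ℝ) / 2))⁻¹ *
      ∫ y, F (k * ((2 : ℝ) ^ j)⁻¹ + ((2 : ℝ) ^ j)⁻¹ * y) * g y := by
  have h2 : (2 : ℝ) ^ j ≠ 0 := by positivity
  have h3 : (2 : ℝ) ^ ((j : ℝ) / 2) ≠ 0 := by positivity
  have h : ∀ x, F x * dyadic g j k x = (2 : ℝ) ^ ((j : ℝ) / 2) *
      (fun y => F (k * ((2 : ℝ) ^ j)⁻¹ + ((2 : ℝ) ^ j)⁻¹ * y) * g y) ((2 : ℝ) ^ j * x - k) := by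
    intro x
    have : (k : ℝ) * ((2 : ℝ) ^ j)⁻¹ + ((2 : ℝ) ^ j)⁻¹ * ((2 : ℝ) ^ j * x - k) = x := by
      field_simp; ring
    simp only [dyadic, this]
    ring
  simp_rw [h]
  rw [integral_const_mul, integral_affine
    (fun y => F (k * ((2 : ℝ) ^ j)⁻¹ + ((2 : ℝ) ^ j)⁻¹ * y) * g y), ← mul_assoc]
  congr 1
  rw [← sqrt_dyadic_sq j]
  field_simp

lemma measurable_dyadic {g : ℝ → ℝ} (hg : Measurable g) (j k : ℤ) : Measurable (dyadic g j k) := by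
  unfold dyadic
  exact (hg.comp (by fun_prop)).const_mul _

lemma abs_dyadic_le {g : ℝ → ℝ} {B : ℝ} (hB : ∀ x, |g x| ≤ B) (j k : ℤ) (x : ℝ) :
    |dyadic g j k x| ≤ (2 : ℝ) ^ ((j : ℝ) / 2) * B := by
  rw [dyadic, abs_mul, abs_of_pos (by positivity : (0 : ℝ) < 2 ^ ((j : ℝ) / 2))]
  gcongr
  exact hB _

namespace IsBoundedPair

variable {N : ℕ} {φ ψ : ℝ → ℝ} {A B : ℝ}

lemma bound_nonneg (h : IsBoundedPair N φ ψ A B) : 0 ≤ B := (abs_nonneg _).trans (h.father_le 0)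

lemma integrable_father (h : IsBoundedPair N φ ψ A B) : Integrable φ :=
  integrable_of_bounded_of_support h.measurable_father h.father_le h.father_zero

lemma integrable_mother (h : IsBoundedPair N φ ψ A B) : Integrable ψ :=
  integrable_of_bounded_of_support h.measurable_mother h.mother_le h.mother_zero

/-- Since `φ` is orthogonal to `ψ_{jk}` for `j ≥ 0`, `F` may be replaced by `F - φ`. A smooth
function close to `φ` in `L¹` is thus almost orthogonal to the wavelets of a fixed level. -/
lemma abs_integral_mother_le (h : IsBoundedPair N φ ψ A B)
    {F : ℝ → ℝ} (hF : Integrable F) (j : ℕ) (k : ℤ) :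
    |∫ y, F (k * ((2 : ℝ) ^ j)⁻¹ + ((2 : ℝ) ^ j)⁻¹ * y) * ψ y| ≤
      (2 : ℝ) ^ j * B * ∫ x, |F x - φ x| := by
  have e := integral_mul_dyadic F ψ j k
  rw [zpow_natCast] at e
  have h3 : (2 : ℝ) ^ (((j : ℤ) : ℝ) / 2) ≠ 0 := by positivity
  rw [eq_inv_mul_iff_mul_eq₀ h3] at e
  have hi : ∀ {G : ℝ → ℝ}, Integrable G → Integrable (fun x => G x * dyadic ψ j k x) := fun hG =>
    hG.mul_bdd (c := (2 : ℝ) ^ (((j : ℤ) : ℝ) / 2) * B)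
      (measurable_dyadic h.measurable_mother j k).aestronglyMeasurable
      (Filter.Eventually.of_forall fun x => abs_dyadic_le h.mother_le j k x)
  have h0 : ∫ x, φ x * dyadic ψ j k x = 0 := by
    have := h.father_mother j 0 k
    simpa [dyadic_zero] using this
  have h1 : ∫ x, F x * dyadic ψ j k x = ∫ x, (F x - φ x) * dyadic ψ j k x := by
    simp_rw [sub_mul]
    rw [integral_sub (hi hF) (hi h.integrable_father), h0, sub_zero]
  rw [← e, h1, abs_mul, abs_of_pos (by positivity : (0 : ℝ) < 2 ^ (((j : ℤ) : ℝ) / 2))]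
  have h4 : |∫ x, (F x - φ x) * dyadic ψ j k x| ≤
      (2 : ℝ) ^ (((j : ℤ) : ℝ) / 2) * B * ∫ x, |F x - φ x| := by
    rw [← integral_const_mul]
    refine abs_integral_le_integral_abs.trans (integral_mono
      (hi (hF.sub h.integrable_father)).abs ((hF.sub h.integrable_father).abs.const_mul _)
      fun x => ?_)
    simp only [abs_mul]
    rw [mul_comm]
    gcongr
    exact abs_dyadic_le h.mother_le j k x
  have h5 := sqrt_dyadic_sq (j : ℤ)
  rw [zpow_natCast] at h5
  calc _ ≤ (2 : ℝ) ^ (((j : ℤ) : ℝ) / 2) * ((2 : ℝ) ^ (((j : ℤ) : ℝ) / 2) * B * ∫ x, |F x - φ x|) := by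
        gcongr
    _ = _ := by rw [← h5]; ring

/-- Strong induction on `m`. If the `m`th moment `μ` were the first nonzero one, pairing a smooth
approximation `F i` of `φ` with `ψ_{jk}` would read off `F i ^{(m)}(k 2^{-j}) μ`, up to a factor and
a Taylor error. That pairing is nearly zero, so the `m`th derivative is small on a dyadic grid,
hence everywhere; by compact support `F i` itself is small. In the limit `φ = 0` almost everywhere,
against `∫ φ² = 1`. -/
lemma moment_eq_zero (h : IsBoundedPair N φ ψ A B)
    {m : ℕ} (hm : m ≤ N) : ∫ y, y ^ m * ψ y = 0 := by
  induction m using Nat.strong_induction_on with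
  | _ m ih =>
  by_contra hμ
  set μ := ∫ y, y ^ m * ψ y with hμdef
  have hμ' : 0 < |μ| := abs_pos.2 hμ
  obtain ⟨g, hg, D, hD⟩ := h.weakDeriv
  obtain ⟨F, hF, hlim, hL1⟩ := exists_smooth_approximation h.measurable_father h.father_le
    h.father_zero hg hD
  set R := A + 1 with hR
  have hR0 : 0 ≤ R := by have := h.pos; positivity
  have hD0 : 0 ≤ D := (abs_nonneg _).trans ((hF 0).2.2.2 0)
  set C := D * (2 * R + 2) ^ (N - m) with hC
  have hC0 : 0 ≤ C := by positivity
  have hder : ∀ i x, |iteratedDeriv (m + 1) (F i) x| ≤ C := fun i x =>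
    abs_iteratedDeriv_le_of_top (hF i).1 hR0 (hF i).2.2.1 (m + 1) (N - m)
      (by rw [show m + 1 + (N - m) = N + 1 by omega]; exact (hF i).2.2.2) x
  set K := ∫ y, |y| ^ (m + 1) * |ψ y| with hK
  set e : ℕ → ℝ := fun i => ∫ x, |F i x - φ x| with he
  -- The first error comes from near-orthogonality, the second from the Taylor remainder, both after
  -- division by `2^{-jm} / m!`.
  have hgrid : ∀ i (j : ℕ) (k : ℤ), |iteratedDeriv m (F i) (k * ((2 : ℝ) ^ j)⁻¹)| * |μ| ≤
      m.factorial * ((2 : ℝ) ^ j) ^ (m + 1) * B * e i + m.factorial * C * K * ((2 : ℝ) ^ j)⁻¹ := by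
    intro i j k
    have h1 := abs_integral_sub_moment_le (hF i).1 (hder i) h.measurable_mother h.mother_le
      h.mother_zero (fun l hl => ih l hl (hl.le.trans hm)) (k * ((2 : ℝ) ^ j)⁻¹)
      (δ := ((2 : ℝ) ^ j)⁻¹) (by positivity)
    have hFi : Integrable (F i) := integrable_of_bounded_of_support
      (hF i).1.continuous.measurable (hF i).2.1 (hF i).2.2.1
    have h2 := h.abs_integral_mother_le hFi j k
    rw [← hμdef] at h1
    set I := ∫ y, F i (k * ((2 : ℝ) ^ j)⁻¹ + ((2 : ℝ) ^ j)⁻¹ * y) * ψ y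
    set a := iteratedDeriv m (F i) (k * ((2 : ℝ) ^ j)⁻¹)
    have h3 : |a * ((2 : ℝ) ^ j)⁻¹ ^ m / m.factorial * μ| ≤
        2 ^ j * B * e i + C * ((2 : ℝ) ^ j)⁻¹ ^ (m + 1) * K := by
      have := abs_sub_abs_le_abs_sub (a * ((2 : ℝ) ^ j)⁻¹ ^ m / m.factorial * μ) I
      rw [abs_sub_comm] at this
      linarith
    have h4 : |a * ((2 : ℝ) ^ j)⁻¹ ^ m / m.factorial * μ| =
        (|a| * |μ|) * (((2 : ℝ) ^ j)⁻¹ ^ m / m.factorial) := by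
      rw [abs_mul, abs_div, abs_mul, abs_of_pos (by positivity : (0 : ℝ) < ((2 : ℝ) ^ j)⁻¹ ^ m),
        Nat.abs_cast]
      ring
    rw [h4, ← le_div_iff₀ (by positivity)] at h3
    refine h3.trans (le_of_eq ?_)
    have hw : (2 : ℝ) ^ j ≠ 0 := by positivity
    generalize (2 : ℝ) ^ j = w at hw ⊢
    simp only [inv_pow, pow_succ]
    field_simp
  -- Every `t` is within `2^{-j}` of a grid point, and the `m`th derivative is Lipschitz with
  -- constant `C`, uniformly in `i`.
  have hall : ∀ i (j : ℕ) t, |iteratedDeriv m (F i) t| ≤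
      (m.factorial * ((2 : ℝ) ^ j) ^ (m + 1) * B * e i + m.factorial * C * K * ((2 : ℝ) ^ j)⁻¹ +
        C * ((2 : ℝ) ^ j)⁻¹ * |μ|) / |μ| := by
    intro i j t
    rw [le_div_iff₀ hμ']
    have h1 := hgrid i j ⌊t * 2 ^ j⌋
    set t' := (⌊t * 2 ^ j⌋ : ℝ) * ((2 : ℝ) ^ j)⁻¹ with ht'
    have h2 : |t - t'| ≤ ((2 : ℝ) ^ j)⁻¹ := by
      have e1 : t - t' = (t * 2 ^ j - ⌊t * 2 ^ j⌋) * ((2 : ℝ) ^ j)⁻¹ := by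
        rw [ht']; field_simp
      rw [e1, abs_mul, abs_of_pos (by positivity : (0 : ℝ) < ((2 : ℝ) ^ j)⁻¹)]
      refine mul_le_of_le_one_left (by positivity) ?_
      rw [abs_le]
      constructor <;> linarith [Int.floor_le (t * 2 ^ j), Int.lt_floor_add_one (t * 2 ^ j)]
    have h3 := Convex.norm_image_sub_le_of_norm_deriv_le (f := iteratedDeriv m (F i)) (C := C)
      (s := Set.univ)
      (fun y _ => (hF i).1.differentiable_iteratedDeriv m (by exact_mod_cast WithTop.coe_lt_top m) y)
      (fun y _ => by rw [← iteratedDeriv_succ]; exact hder i y) convex_univ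
      (Set.mem_univ t') (Set.mem_univ t)
    rw [Real.norm_eq_abs, Real.norm_eq_abs] at h3
    have h4 := abs_sub_abs_le_abs_sub (iteratedDeriv m (F i) t) (iteratedDeriv m (F i) t')
    have h5 : |iteratedDeriv m (F i) t| ≤ |iteratedDeriv m (F i) t'| + C * ((2 : ℝ) ^ j)⁻¹ := by
      have := mul_le_mul_of_nonneg_left h2 hC0
      linarith
    calc _ ≤ (|iteratedDeriv m (F i) t'| + C * ((2 : ℝ) ^ j)⁻¹) * |μ| := by gcongr
      _ ≤ _ := by rw [add_mul]; gcongr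
  -- The order of limits matters: `e i` is multiplied by `2^{j(m+1)}`, so `i → ∞` is taken at fixed
  -- `j`, and only then `j → ∞`.
  have hzero : ∀ᵐ x ∂(volume : Measure ℝ), φ x = 0 := by
    filter_upwards [hlim] with x hx
    have h1 : ∀ j : ℕ, |φ x| ≤ (m.factorial * ((2 : ℝ) ^ j) ^ (m + 1) * B * 0 +
        m.factorial * C * K * ((2 : ℝ) ^ j)⁻¹ + C * ((2 : ℝ) ^ j)⁻¹ * |μ|) / |μ| *
          (2 * R + 2) ^ m := by
      intro j
      refine le_of_tendsto_of_tendsto' hx.abs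
        ((((hL1.const_mul _).add_const _).add_const _).div_const _ |>.mul_const _) fun i => ?_
      have := abs_iteratedDeriv_le_of_top (hF i).1 hR0 (hF i).2.2.1 0 m
        (by rw [zero_add]; exact hall i j) x
      simpa using this
    have h2 : Filter.Tendsto (fun j : ℕ => (m.factorial * C * K * ((2 : ℝ) ^ j)⁻¹ +
        C * ((2 : ℝ) ^ j)⁻¹ * |μ|) / |μ| * (2 * R + 2) ^ m) Filter.atTop (nhds
        ((m.factorial * C * K * 0 + C * 0 * |μ|) / |μ| * (2 * R + 2) ^ m)) := by
      have h3 : Filter.Tendsto (fun j : ℕ => ((2 : ℝ) ^ j)⁻¹) Filter.atTop (nhds 0) :=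
        (tendsto_pow_atTop_atTop_of_one_lt one_lt_two).inv_tendsto_atTop
      exact (((h3.const_mul _).add ((h3.const_mul _).mul_const _)).div_const _).mul_const _
    have h4 := ge_of_tendsto' h2 (fun j => by simpa using h1 j)
    simpa using h4
  have : ∫ x, φ x * φ x = 0 := integral_eq_zero_of_ae (hzero.mono fun x hx => by simp [hx])
  rw [h.father_norm] at this
  exact one_ne_zero this

lemma integral_mother_eq_zero (h : IsBoundedPair N φ ψ A B) : ∫ y, ψ y = 0 := by
  simpa using h.moment_eq_zero (Nat.zero_le N)

/-- Decay of the wavelet coefficients of a smooth function. -/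
lemma abs_waveletCoeff_le (h : IsBoundedPair N φ ψ A B)
    {f : ℝ → ℝ} (hf : ContDiff ℝ (⊤ : ℕ∞) f) {D : ℝ}
    (hD : ∀ x, |iteratedDeriv (N + 1) f x| ≤ D) (j : ℕ) (k : ℤ) :
    |waveletCoeff ψ f j k| ≤ ((2 : ℝ) ^ ((j : ℝ) / 2))⁻¹ * (D * ((2 : ℝ) ^ j)⁻¹ ^ (N + 1) *
      ∫ y, |y| ^ (N + 1) * |ψ y|) := by
  have h1 := abs_integral_sub_moment_le hf hD h.measurable_mother h.mother_le
    h.mother_zero (fun l hl => h.moment_eq_zero hl.le) (k * ((2 : ℝ) ^ j)⁻¹)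
    (δ := ((2 : ℝ) ^ j)⁻¹) (by positivity)
  rw [h.moment_eq_zero le_rfl, mul_zero, sub_zero] at h1
  rw [waveletCoeff, integral_mul_dyadic, zpow_natCast, Int.cast_natCast, abs_mul,
    abs_of_pos (by positivity : (0 : ℝ) < ((2 : ℝ) ^ ((j : ℝ) / 2))⁻¹)]
  gcongr

end IsBoundedPair

/-! ### Sequence norms -/

/-- The exponent `(1 / p).toReal` is `0` at `p = ∞`, so this one form also covers the sup norm. -/
lemma eLpNorm_count_le {ι ε : Type*} [MeasurableSpace ι] [MeasurableSingletonClass ι]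
    [TopologicalSpace ε] [ENormedAddMonoid ε] {f : ι → ε} {C : ℝ≥0∞} (S : Finset ι) (p : ℝ≥0∞)
    (h0 : ∀ i ∉ S, f i = 0) (hC : ∀ i, ‖f i‖ₑ ≤ C) :
    eLpNorm f p Measure.count ≤ C * (S.card : ℝ≥0∞) ^ (1 / p).toReal := by
  rw [← eLpNorm_restrict_eq_of_support_subset (s := (S : Set ι))
    (fun i hi => by by_contra h; exact hi (h0 i h))]
  refine (eLpNorm_le_of_ae_enorm_bound (Filter.Eventually.of_forall hC)).trans (le_of_eq ?_)
  rw [Measure.restrict_apply MeasurableSet.univ, Set.univ_inter, Measure.count_apply_finset,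
    smul_eq_mul, one_div, ENNReal.toReal_inv]

lemma eLpNorm_geometric_lt_top {G : ℕ → ℝ≥0∞} {q : ℝ≥0∞} (hq : 1 ≤ q) {c ρ : ℝ} (hc : 0 ≤ c)
    (hρ : 0 ≤ ρ) (hρ1 : ρ < 1) (hG : ∀ j, G j ≤ ENNReal.ofReal (c * ρ ^ j)) :
    eLpNorm G q Measure.count < ∞ := by
  have hq0 : q ≠ 0 := (one_pos.trans_le hq).ne'
  by_cases hqt : q = ∞
  · subst hqt
    refine lt_of_le_of_lt (eLpNorm_le_of_ae_enorm_bound (C := ENNReal.ofReal c)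
      (Filter.Eventually.of_forall fun j => ?_)) (by simp)
    refine (hG j).trans (ENNReal.ofReal_le_ofReal ?_)
    exact mul_le_of_le_one_right hc (pow_le_one₀ hρ hρ1.le)
  · rw [eLpNorm_lt_top_iff_lintegral_rpow_enorm_lt_top hq0 hqt, lintegral_count]
    have hq1 : 0 < q.toReal := ENNReal.toReal_pos hq0 hqt
    have hs : Summable fun j : ℕ => c ^ q.toReal * (ρ ^ q.toReal) ^ j :=
      (summable_geometric_of_lt_one (Real.rpow_nonneg hρ _)
        (Real.rpow_lt_one hρ hρ1 hq1)).mul_left _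
    refine lt_of_le_of_lt (ENNReal.tsum_le_tsum fun j => ?_) hs.tsum_ofReal_lt_top
    rw [enorm_eq_self]
    refine (ENNReal.rpow_le_rpow (hG j) hq1.le).trans (le_of_eq ?_)
    rw [ENNReal.ofReal_rpow_of_nonneg (by positivity) hq1.le, Real.mul_rpow hc (by positivity),
      ← Real.rpow_natCast, ← Real.rpow_natCast, ← Real.rpow_mul hρ, ← Real.rpow_mul hρ, mul_comm (j : ℝ)]

lemma two_rpow_eq_ofReal (x : ℝ) : (2 : ℝ≥0∞) ^ x = ENNReal.ofReal ((2 : ℝ) ^ x) := by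
  rw [← ENNReal.ofReal_rpow_of_pos two_pos]
  simp

/-! ### The Besov norm -/

lemma waveletCoeff_eq_zero {g f : ℝ → ℝ} {A T : ℝ} (hg : ∀ x, A < |x| → g x = 0)
    (hf : ∀ x, T < |x| → f x = 0) (j : ℕ) {k : ℤ} (hk : (2 : ℝ) ^ j * T + A < |(k : ℝ)|) :
    waveletCoeff g f j k = 0 := by
  refine integral_eq_zero_of_ae (Filter.Eventually.of_forall fun x => ?_)
  by_cases hx : T < |x|
  · simp [hf x hx]
  · have h1 := abs_sub_abs_le_abs_sub (k : ℝ) ((2 : ℝ) ^ j * x)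
    rw [abs_sub_comm, abs_mul, abs_of_pos (by positivity : (0 : ℝ) < 2 ^ j)] at h1
    have h2 : (2 : ℝ) ^ j * |x| ≤ 2 ^ j * T := by gcongr; exact not_lt.1 hx
    have : g ((2 : ℝ) ^ (j : ℤ) * x - k) = 0 := hg _ (by rw [zpow_natCast]; linarith)
    simp only [dyadic, this, mul_zero, Pi.zero_apply]

/-- By compactness of the supports only indices with `|k| ≤ 2^j T + A` contribute at level `j`.
After rounding up there are at most `2^{j+1} T + 2A + 3` of them, and the constants are absorbed
into the factor `2^j`. -/
lemma eLpNorm_waveletCoeff_le {g f : ℝ → ℝ} {A T : ℝ} (hA : 0 ≤ A) (hT : 0 ≤ T)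
    (hg : ∀ x, A < |x| → g x = 0) (hf : ∀ x, T < |x| → f x = 0) (j : ℕ) {b : ℝ}
    (hb : ∀ k, |waveletCoeff g f j k| ≤ b) (p : ℝ≥0∞) :
    eLpNorm (fun k : ℤ => waveletCoeff g f j k) p Measure.count ≤
      ENNReal.ofReal (b * ((2 : ℝ) ^ j * (2 * T + 2 * A + 3)) ^ (1 / p).toReal) := by
  have hb0 : 0 ≤ b := (abs_nonneg _).trans (hb 0)
  set K : ℕ := ⌈(2 : ℝ) ^ j * T + A⌉₊ with hK
  have h1 : (2 : ℝ) ^ j * T + A ≤ K := Nat.le_ceil _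
  have h2 : (K : ℝ) < 2 ^ j * T + A + 1 := Nat.ceil_lt_add_one (by positivity)
  refine (eLpNorm_count_le (C := ENNReal.ofReal b) (Finset.Icc (-(K : ℤ)) K) p ?_ ?_).trans ?_
  · intro k hk
    refine waveletCoeff_eq_zero hg hf j (h1.trans_lt ?_)
    have : (K : ℤ) < |k| := by
      rw [Finset.mem_Icc, ← abs_le] at hk; omega
    exact_mod_cast this
  · intro k
    rw [← ofReal_norm]
    exact ENNReal.ofReal_le_ofReal (hb k)
  · rw [ENNReal.ofReal_mul hb0]
    gcongr
    rw [← ENNReal.ofReal_rpow_of_nonneg (by positivity) ENNReal.toReal_nonneg]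
    refine ENNReal.rpow_le_rpow ?_ ENNReal.toReal_nonneg
    rw [← ENNReal.ofReal_natCast]
    refine ENNReal.ofReal_le_ofReal ?_
    have h3 : ((Finset.Icc (-(K : ℤ)) K).card : ℝ) = 2 * K + 1 := by
      rw [Int.card_Icc]
      have : ((K : ℤ) + 1 - -(K : ℤ)).toNat = 2 * K + 1 := by omega
      rw [this]; push_cast; ring
    rw [h3]
    have h4 : (1 : ℝ) ≤ 2 ^ j := one_le_pow₀ one_le_two
    nlinarith

lemma besovJ_smul_le (φ ψ : ℝ → ℝ) (s : ℝ) (p q : ℝ≥0∞) (c : ℝ) (f : ℝ → ℝ) :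
    besovJ φ ψ s p q (fun x => c * f x) ≤ ‖c‖ₑ * besovJ φ ψ s p q f := by
  have h : ∀ g j k, waveletCoeff g (fun x => c * f x) j k = c * waveletCoeff g f j k := by
    intro g j k
    simp only [waveletCoeff, mul_assoc, integral_const_mul]
  have h1 : ∀ g j, eLpNorm (fun k : ℤ => waveletCoeff g (fun x => c * f x) j k) p Measure.count =
      ‖c‖ₑ * eLpNorm (fun k : ℤ => waveletCoeff g f j k) p Measure.count := by
    intro g j
    simp_rw [h]
    exact eLpNorm_const_smul c _ p _
  rw [besovJ, besovJ, mul_add]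
  simp_rw [h1]
  gcongr
  refine eLpNorm_le_mul_eLpNorm_of_ae_le_mul' (c := ‖c‖₊)
    (Filter.Eventually.of_forall fun j => ?_) q
  simp only [enorm_eq_self]
  rw [mul_left_comm]
  rfl

namespace IsBoundedPair

variable {N : ℕ} {φ ψ : ℝ → ℝ} {A B : ℝ}

lemma besovJ_add_le (h : IsBoundedPair N φ ψ A B)
    (s : ℝ) {p q : ℝ≥0∞} (hp : 1 ≤ p) (hq : 1 ≤ q) {f f' : ℝ → ℝ}
    (hf : Integrable f) (hf' : Integrable f') :
    besovJ φ ψ s p q (fun x => f x + f' x) ≤ besovJ φ ψ s p q f + besovJ φ ψ s p q f' := by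
  have hi : ∀ {g G : ℝ → ℝ}, Measurable g → (∀ x, |g x| ≤ B) → Integrable G → ∀ j k : ℤ,
      Integrable (fun x => G x * dyadic g j k x) := fun hg hb hG j k =>
    hG.mul_bdd (c := (2 : ℝ) ^ ((j : ℝ) / 2) * B) (measurable_dyadic hg j k).aestronglyMeasurable
      (Filter.Eventually.of_forall fun x => abs_dyadic_le hb j k x)
  have hadd : ∀ {g : ℝ → ℝ}, Measurable g → (∀ x, |g x| ≤ B) → ∀ j k : ℤ,
      waveletCoeff g (fun x => f x + f' x) j k = waveletCoeff g f j k + waveletCoeff g f' j k := by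
    intro g hg hb j k
    simp only [waveletCoeff, add_mul]
    exact integral_add (hi hg hb hf j k) (hi hg hb hf' j k)
  have h1 : ∀ {g : ℝ → ℝ}, Measurable g → (∀ x, |g x| ≤ B) → ∀ j : ℤ,
      eLpNorm (fun k : ℤ => waveletCoeff g (fun x => f x + f' x) j k) p Measure.count ≤
      eLpNorm (fun k : ℤ => waveletCoeff g f j k) p Measure.count +
      eLpNorm (fun k : ℤ => waveletCoeff g f' j k) p Measure.count := by
    intro g hg hb j
    simp_rw [hadd hg hb]
    exact eLpNorm_add_le (f := fun k : ℤ => waveletCoeff g f j k)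
      (measurable_of_countable _).aestronglyMeasurable
      (measurable_of_countable _).aestronglyMeasurable hp
  simp only [besovJ]
  rw [add_add_add_comm]
  refine add_le_add (h1 h.measurable_father h.father_le 0) ?_
  refine le_trans ?_ (eLpNorm_add_le (measurable_of_countable _).aestronglyMeasurable
      (measurable_of_countable _).aestronglyMeasurable hq)
  refine eLpNorm_mono_enorm fun j => ?_
  simp only [enorm_eq_self, Pi.add_apply]
  rw [← mul_add]
  gcongr
  exact h1 h.measurable_mother h.mother_le j

/-- Smooth functions with compact support have finite Besov norm. -/
lemma besovJ_lt_top (h : IsBoundedPair N φ ψ A B)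
    {s : ℝ} (hsN : s < N + 1) (p : ℝ≥0∞) {q : ℝ≥0∞} (hq : 1 ≤ q)
    {f : ℝ → ℝ} (hf : ContDiff ℝ (⊤ : ℕ∞) f) {T : ℝ} (hT : 0 ≤ T) (hfT : ∀ x, T < |x| → f x = 0) :
    besovJ φ ψ s p q f < ∞ := by
  have hsupp : HasCompactSupport f := HasCompactSupport.of_support_subset_isCompact
    (isCompact_Icc (a := -T) (b := T)) (fun x hx => by
      by_contra hx'
      rw [Set.mem_Icc, ← abs_le] at hx'
      exact hx (hfT x (not_le.1 hx')))
  have hfi : Integrable f := hf.continuous.integrable_of_hasCompactSupport hsupp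
  obtain ⟨D, hD⟩ : ∃ D, ∀ x, |iteratedDeriv (N + 1) f x| ≤ D := by
    obtain ⟨D, hD⟩ := (isCompact_Icc (a := -T) (b := T)).exists_bound_of_continuousOn
      (hf.continuous_iteratedDeriv (N + 1) (by exact_mod_cast le_top)).continuousOn
    refine ⟨max D 0, fun x => ?_⟩
    by_cases hx : T < |x|
    · rw [iteratedDeriv_eq_zero_of_support hfT _ hx]; simp
    · exact (hD x (by rw [Set.mem_Icc, ← abs_le]; exact not_lt.1 hx)).trans (le_max_left _ _)
  have hD0 : 0 ≤ D := (abs_nonneg _).trans (hD 0)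
  have hA := h.pos.le
  refine ENNReal.add_lt_top.2 ⟨?_, ?_⟩
  · have hb : ∀ k, |waveletCoeff φ f (0 : ℕ) k| ≤ ∫ x, |f x| * B := by
      intro k
      refine abs_integral_le_integral_abs.trans (integral_mono_of_nonneg
        (Filter.Eventually.of_forall fun _ => abs_nonneg _) (hfi.abs.mul_const _)
        (Filter.Eventually.of_forall fun x => ?_))
      simp only [Nat.cast_zero, abs_mul, dyadic_zero]
      gcongr
      exact h.father_le _
    exact (eLpNorm_waveletCoeff_le hA hT h.father_zero hfT 0 hb p).trans_lt ENNReal.ofReal_lt_top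
  · set K := ∫ y, |y| ^ (N + 1) * |ψ y| with hK
    have hK0 : 0 ≤ K := integral_nonneg fun y => by positivity
    set ip := (1 / p).toReal
    set W := 2 * T + 2 * A + 3 with hW
    have hW0 : 0 ≤ W := by positivity
    -- The weight `2^{j(s+1/2-1/p)}`, the coefficient size `2^{-j/2} 2^{-j(N+1)}` and the count
    -- `2^{j/p}` multiply to `2^{j(s-N-1)}`, a geometric sequence of ratio less than `1`.
    refine eLpNorm_geometric_lt_top hq (c := D * K * W ^ ip) (ρ := (2 : ℝ) ^ (s - (N + 1)))
      (by positivity) (by positivity)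
      (Real.rpow_lt_one_of_one_lt_of_neg one_lt_two (by linarith)) fun j => ?_
    rw [two_rpow_eq_ofReal]
    refine (mul_le_mul_right (eLpNorm_waveletCoeff_le hA hT h.mother_zero hfT j
      (fun k => h.abs_waveletCoeff_le hf hD j k) p) _).trans (le_of_eq ?_)
    rw [← ENNReal.ofReal_mul (by positivity)]
    congr 1
    have e1 : (((2 : ℝ) ^ j)⁻¹) ^ (N + 1) = 2 ^ (-(j * (N + 1) : ℝ)) := by
      rw [Real.rpow_neg two_pos.le, inv_pow, ← pow_mul, ← Real.rpow_natCast]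
      push_cast; rfl
    have e2 : ((2 : ℝ) ^ (s - (N + 1))) ^ j = 2 ^ ((s - (N + 1)) * j) := by
      rw [← Real.rpow_natCast, ← Real.rpow_mul two_pos.le]
    have e3 : ((2 : ℝ) ^ j * W) ^ ip = 2 ^ (j * ip) * W ^ ip := by
      rw [Real.mul_rpow (by positivity) hW0, ← Real.rpow_natCast, ← Real.rpow_mul two_pos.le]
    rw [e1, e2, e3, ← Real.rpow_neg two_pos.le]
    have e4 : (2 : ℝ) ^ ((s - (N + 1)) * j) = 2 ^ ((j : ℝ) * (s + 1 / 2 - ip)) *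
        2 ^ (-((j : ℝ) / 2)) * 2 ^ (-(j * (N + 1) : ℝ)) * 2 ^ (j * ip) := by
      rw [← Real.rpow_add two_pos, ← Real.rpow_add two_pos, ← Real.rpow_add two_pos]
      congr 1; ring
    rw [e4]
    ring

/-- The Besov norm of a single wavelet. -/
lemma besovJ_dyadic_le (h : IsBoundedPair N φ ψ A B)
    (s : ℝ) (p q : ℝ≥0∞) (j : ℕ) (k : ℤ) :
    besovJ φ ψ s p q (dyadic ψ j k) ≤
      ENNReal.ofReal ((2 : ℝ) ^ ((j : ℝ) * (s + 1 / 2 - (1 / p).toReal))) := by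
  have hα : ∀ l, waveletCoeff φ (dyadic ψ j k) 0 l = 0 := by
    intro l
    rw [← h.father_mother j l k]
    simp only [waveletCoeff, mul_comm]
  have hβ : ∀ (i : ℕ) (l : ℤ), waveletCoeff ψ (dyadic ψ j k) i l = if i = j ∧ l = k then 1 else 0 := by
    intro i l
    rw [waveletCoeff, h.mother_mother]
    simp only [Nat.cast_inj, eq_comm]
  rw [besovJ]
  simp_rw [hα, hβ]
  rw [eLpNorm_zero', zero_add]
  have hin : ∀ i : ℕ, eLpNorm (fun l : ℤ => if i = j ∧ l = k then (1 : ℝ) else 0) p Measure.count ≤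
      if i = j then 1 else 0 := by
    intro i
    by_cases hi : i = j
    · simp only [hi, true_and, if_true]
      refine (eLpNorm_count_le (C := 1) {k} p (fun l hl => ?_) (fun l => ?_)).trans (by simp)
      · rw [if_neg (by simpa using hl)]
      · split_ifs <;> simp
    · simp [hi]
  refine (eLpNorm_count_le (C := ENNReal.ofReal ((2 : ℝ) ^ ((j : ℝ) * (s + 1 / 2 - (1 / p).toReal))))
    {j} q (fun i hi => ?_) (fun i => ?_)).trans (by simp)
  · have := hin i
    rw [if_neg (by simpa using hi), nonpos_iff_eq_zero] at this
    rw [this, mul_zero]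
  · rw [enorm_eq_self]
    refine (mul_le_mul_right (hin i) _).trans ?_
    by_cases hi : i = j
    · rw [hi, two_rpow_eq_ofReal]; simp
    · simp [hi]

end IsBoundedPair

/-! ### Perturbed densities -/

lemma integral_abs_dyadic_rpow (g : ℝ → ℝ) (j : ℕ) (k : ℤ) (r : ℝ) :
    ∫ x, |dyadic g j k x| ^ r = (2 : ℝ) ^ ((j : ℝ) * (r / 2 - 1)) * ∫ x, |g x| ^ r := by
  have h1 : ∀ x, |dyadic g j k x| ^ r = ((2 : ℝ) ^ ((j : ℝ) / 2)) ^ r *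
      (fun y => |g y| ^ r) ((2 : ℝ) ^ (j : ℤ) * x - k) := by
    intro x
    rw [dyadic, abs_mul, Int.cast_natCast,
      abs_of_pos (by positivity : (0 : ℝ) < 2 ^ ((j : ℝ) / 2)),
      Real.mul_rpow (by positivity) (abs_nonneg _)]
  simp_rw [h1]
  rw [integral_const_mul, integral_affine (fun y => |g y| ^ r), ← mul_assoc]
  congr 1
  rw [zpow_natCast, ← Real.rpow_natCast, ← Real.rpow_mul two_pos.le, ← Real.rpow_neg two_pos.le,
    ← Real.rpow_add two_pos]
  congr 1; ring

lemma integral_abs_perturbation (g f : ℝ → ℝ) {γ : ℝ} (hγ : 0 ≤ γ) (j : ℕ) (k : ℤ) :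
    ∫ x, |(f x + γ * dyadic g j k x) - f x| = γ * (2 : ℝ) ^ (-((j : ℝ) / 2)) * ∫ x, |g x| := by
  have := integral_abs_dyadic_rpow g j k 1
  simp only [Real.rpow_one] at this
  simp_rw [add_sub_cancel_left, abs_mul, abs_of_nonneg hγ]
  rw [integral_const_mul, this, mul_assoc]
  congr 4
  ring

namespace IsBoundedPair

variable {N : ℕ} {φ ψ : ℝ → ℝ} {A B : ℝ}

/-- A density in the interior of the Besov ellipsoid which is bounded from below on an interval. -/
lemma exists_center (h : IsBoundedPair N φ ψ A B)
    {s : ℝ} {p q : ℝ≥0∞} {L T : ℝ} (hp : 1 ≤ p) (hq : 1 ≤ q) (hsN : s < N + 1)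
    (hL : 0 < L) (hT : 0 < T)
    (hne : ∃ f ∈ densityClass φ ψ s p q L T, besovJ φ ψ s p q f < ENNReal.ofReal L) :
    ∃ f ∈ densityClass φ ψ s p q L T, ∃ c > 0, ∃ δ > 0, (∀ x, |x| ≤ T / 2 → c ≤ f x) ∧
      besovJ φ ψ s p q f + ENNReal.ofReal δ ≤ ENNReal.ofReal L := by
  obtain ⟨f, ⟨hf0, hfi, hf1, hfT, -⟩, hJ⟩ := hne
  let b : ContDiffBump (0 : ℝ) := ⟨T / 2, T, by positivity, by linarith⟩
  set g : ℝ → ℝ := b.normed volume with hg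
  have hgT : ∀ x, T < |x| → g x = 0 := by
    intro x hx
    rw [← Function.notMem_support, hg, b.support_normed_eq, Metric.mem_ball, dist_zero_right, not_lt]
    exact hx.le
  have hgs : ContDiff ℝ (⊤ : ℕ∞) g := b.contDiff_normed
  have hg0 : ∀ x, 0 ≤ g x := b.nonneg_normed
  have hgi : Integrable g := b.integrable_normed
  have hg1 : ∫ x, g x = 1 := b.integral_normed
  obtain ⟨c, hc, hcg⟩ : ∃ c > 0, ∀ x, |x| ≤ T / 2 → c ≤ g x := by
    refine ⟨1 / ∫ x, b x, one_div_pos.2 b.integral_pos, fun x hx => ?_⟩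
    rw [hg, b.normed_def, b.one_of_mem_closedBall]
    rw [Metric.mem_closedBall, dist_zero_right]
    exact hx
  have hJg := h.besovJ_lt_top hsN p hq hgs hT.le hgT
  set a := (besovJ φ ψ s p q f).toReal with ha
  set d := (besovJ φ ψ s p q g).toReal with hd
  have hJf : besovJ φ ψ s p q f = ENNReal.ofReal a :=
    (ENNReal.ofReal_toReal (hJ.trans ENNReal.ofReal_lt_top).ne).symm
  have hJg' : besovJ φ ψ s p q g = ENNReal.ofReal d := (ENNReal.ofReal_toReal hJg.ne).symm
  have ha0 : 0 ≤ a := ENNReal.toReal_nonneg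
  have hd0 : 0 ≤ d := ENNReal.toReal_nonneg
  have haL : a < L := by
    rw [hJf] at hJ
    exact (ENNReal.ofReal_lt_ofReal_iff hL).1 hJ
  -- The weight of the bump is small enough to use at most half of the slack `L - a`; the other half
  -- is the margin `δ`. Writing `d + 1` avoids division by zero.
  set ε := min (1 / 2) ((L - a) / (2 * (d + 1))) with hε
  have hε0 : 0 < ε := by
    have : 0 < L - a := sub_pos.2 haL
    exact lt_min (by norm_num) (by positivity)
  have hε1 : ε ≤ 1 / 2 := min_le_left _ _
  have hεd : ε * d ≤ (L - a) / 2 := by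
    have h1 : ε ≤ (L - a) / (2 * (d + 1)) := min_le_right _ _
    have h2 : ε * (2 * (d + 1)) ≤ L - a := by rwa [le_div_iff₀ (by positivity)] at h1
    linarith
  have hJmix : besovJ φ ψ s p q (fun x => (1 - ε) * f x + ε * g x) ≤
      ENNReal.ofReal (a + (L - a) / 2) := by
    refine (h.besovJ_add_le s hp hq (hfi.const_mul _) (hgi.const_mul _)).trans ?_
    refine (add_le_add (besovJ_smul_le _ _ _ _ _ _ _) (besovJ_smul_le _ _ _ _ _ _ _)).trans ?_
    rw [hJf, hJg', Real.enorm_of_nonneg (by linarith), Real.enorm_of_nonneg hε0.le,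
      ← ENNReal.ofReal_mul (by linarith), ← ENNReal.ofReal_mul hε0.le,
      ← ENNReal.ofReal_add (mul_nonneg (by linarith) ha0) (by positivity)]
    refine ENNReal.ofReal_le_ofReal ?_
    nlinarith
  refine ⟨fun x => (1 - ε) * f x + ε * g x, ⟨fun x => ?_, ?_, ?_, fun x hx => ?_, ?_⟩,
    ε * c, by positivity, (L - a) / 2, by linarith, fun x hx => ?_, ?_⟩
  · exact add_nonneg (mul_nonneg (by linarith) (hf0 x)) (mul_nonneg hε0.le (hg0 x))
  · exact (hfi.const_mul _).add (hgi.const_mul _)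
  · rw [integral_add (hfi.const_mul _) (hgi.const_mul _), integral_const_mul, integral_const_mul,
      hf1, hg1]
    ring
  · by_contra hx'
    have h1 : f x = 0 := by
      by_contra h2
      exact hx' (hfT h2)
    rw [Set.mem_Icc, ← abs_le, not_le] at hx'
    refine hx ?_
    simp [h1, hgT x hx']
  · exact hJmix.trans (ENNReal.ofReal_le_ofReal (by linarith))
  · have := mul_le_mul_of_nonneg_left (hcg x hx) hε0.le
    have := mul_nonneg (by linarith : 0 ≤ 1 - ε) (hf0 x)
    linarith
  · refine (add_le_add_left hJmix _).trans ?_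
    rw [← ENNReal.ofReal_add (by linarith) (by linarith)]
    exact ENNReal.ofReal_le_ofReal (by linarith)

lemma integrable_dyadic_mother (h : IsBoundedPair N φ ψ A B)
    (j k : ℤ) : Integrable (dyadic ψ j k) :=
  (integrable_affine h.integrable_mother j k).const_mul _

lemma integral_dyadic_mother (h : IsBoundedPair N φ ψ A B)
    (j k : ℤ) : ∫ x, dyadic ψ j k x = 0 := by
  have := integral_mul_dyadic (fun _ => 1) ψ j k
  simpa [h.integral_mother_eq_zero] using this

lemma dyadic_mother_eq_zero (h : IsBoundedPair N φ ψ A B)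
    {j : ℕ} {k : ℤ} {T x : ℝ} (hk : |(k : ℝ)| + A ≤ (2 : ℝ) ^ j * T)
    (hx : T < |x|) : dyadic ψ j k x = 0 := by
  have h1 := abs_sub_abs_le_abs_sub ((2 : ℝ) ^ j * x) k
  rw [abs_mul, abs_of_pos (by positivity : (0 : ℝ) < 2 ^ j)] at h1
  have h2 : (2 : ℝ) ^ j * T < 2 ^ j * |x| := by gcongr
  have : ψ ((2 : ℝ) ^ (j : ℤ) * x - k) = 0 := h.mother_zero _ (by rw [zpow_natCast]; linarith)
  rw [dyadic, this, mul_zero]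

lemma integrable_abs_dyadic_rpow (h : IsBoundedPair N φ ψ A B)
    (j : ℕ) (k : ℤ) {r : ℝ} (hr : 1 ≤ r) :
    Integrable (fun x => |dyadic ψ j k x| ^ r) := by
  refine integrable_of_bounded_of_support (A := |(k : ℝ)| + A)
    (B := ((2 : ℝ) ^ (((j : ℤ) : ℝ) / 2) * B) ^ r) ?_ (fun x => ?_) (fun x hx => ?_)
  · exact (measurable_dyadic h.measurable_mother _ _).abs.pow_const _
  · rw [abs_of_nonneg (by positivity)]
    exact Real.rpow_le_rpow (abs_nonneg _) (abs_dyadic_le h.mother_le _ _ _) (by linarith)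
  · rw [h.dyadic_mother_eq_zero (T := |(k : ℝ)| + A) ?_ hx, abs_zero, Real.zero_rpow (by linarith)]
    have h1 : (1 : ℝ) ≤ 2 ^ j := one_le_pow₀ one_le_two
    have := h.pos
    exact le_mul_of_one_le_left (by positivity) h1

lemma integral_abs_mother_rpow_pos (h : IsBoundedPair N φ ψ A B)
    {r : ℝ} (hr : 1 ≤ r) : 0 < ∫ x, |ψ x| ^ r := by
  have hi : Integrable (fun x => |ψ x| ^ r) := by
    have := h.integrable_abs_dyadic_rpow 0 0 hr
    simpa [dyadic] using this
  rw [integral_pos_iff_support_of_nonneg (fun x => by positivity) hi, pos_iff_ne_zero]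
  intro h0
  have h1 : ∫ x, dyadic ψ 0 0 x * dyadic ψ 0 0 x = 1 := by
    rw [h.mother_mother, if_pos ⟨rfl, rfl⟩]
  have h2 : ∀ᵐ x ∂(volume : Measure ℝ), ψ x = 0 := by
    have : ∀ᵐ x ∂(volume : Measure ℝ), x ∉ Function.support (fun x => |ψ x| ^ r) :=
      measure_eq_zero_iff_ae_notMem.1 h0
    filter_upwards [this] with x hx
    rw [Function.notMem_support, Real.rpow_eq_zero (abs_nonneg _) (by linarith)] at hx
    simpa using hx
  rw [integral_eq_zero_of_ae (h2.mono fun x hx => by simp [dyadic_zero, hx])] at h1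
  exact zero_ne_one h1

/-- Small multiples of a wavelet can be added to an interior density. -/
lemma add_mother_mem_densityClass (h : IsBoundedPair N φ ψ A B)
    {s : ℝ} {p q : ℝ≥0∞} {L T : ℝ} (hp : 1 ≤ p) (hq : 1 ≤ q)
    (hsp : (1 / p).toReal ≤ s) (hT : 0 < T) {f : ℝ → ℝ} (hf : f ∈ densityClass φ ψ s p q L T)
    {c δ c₁ : ℝ} (hc : ∀ x, |x| ≤ T / 2 → c ≤ f x)
    (hδ : besovJ φ ψ s p q f + ENNReal.ofReal δ ≤ ENNReal.ofReal L) (hc0 : 0 ≤ c₁) (hc1 : c₁ ≤ δ)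
    (hc2 : c₁ * B ≤ c) (j : ℕ) {k : ℤ} (hk : |(k : ℝ)| + A ≤ (2 : ℝ) ^ j * (T / 2)) :
    (fun x => f x + c₁ * (2 : ℝ) ^ (-((j : ℝ) * (s + 1 / 2 - (1 / p).toReal))) * dyadic ψ j k x) ∈
      densityClass φ ψ s p q L T := by
  obtain ⟨hf0, hfi, hf1, hfT, -⟩ := hf
  set γ := c₁ * (2 : ℝ) ^ (-((j : ℝ) * (s + 1 / 2 - (1 / p).toReal))) with hγ
  have hγ0 : 0 ≤ γ := by positivity
  refine ⟨fun x => ?_, hfi.add ((h.integrable_dyadic_mother j k).const_mul _), ?_, fun x hx => ?_, ?_⟩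
  · dsimp only
    by_cases hx : T / 2 < |x|
    · rw [h.dyadic_mother_eq_zero hk hx, mul_zero, add_zero]
      exact hf0 x
    · have h1 : |γ * dyadic ψ j k x| ≤ c := by
        rw [abs_mul, abs_of_nonneg hγ0]
        refine le_trans ?_ hc2
        refine (mul_le_mul_of_nonneg_left (abs_dyadic_le h.mother_le j k x) hγ0).trans ?_
        rw [hγ, Int.cast_natCast]
        -- The sup norm of the perturbation scales like `2^{-j(s-1/p)}`; `s ≥ 1/p` keeps it bounded,
        -- hence below the lower bound `c` of the density.
        have : (2 : ℝ) ^ (-((j : ℝ) * (s + 1 / 2 - (1 / p).toReal))) * 2 ^ ((j : ℝ) / 2) ≤ 1 := by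
          rw [← Real.rpow_add two_pos]
          refine Real.rpow_le_one_of_one_le_of_nonpos one_le_two ?_
          have : 0 ≤ (j : ℝ) * (s - (1 / p).toReal) := mul_nonneg (by positivity) (sub_nonneg.2 hsp)
          linarith
        have hB := h.bound_nonneg
        calc _ = c₁ * B * ((2 : ℝ) ^ (-((j : ℝ) * (s + 1 / 2 - (1 / p).toReal))) *
              2 ^ ((j : ℝ) / 2)) := by ring
          _ ≤ c₁ * B := mul_le_of_le_one_right (by positivity) this
      have := (abs_le.1 h1).1
      have := hc x (not_lt.1 hx)
      linarith
  · rw [integral_add hfi ((h.integrable_dyadic_mother j k).const_mul _), integral_const_mul,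
      h.integral_dyadic_mother, hf1, mul_zero, add_zero]
  · by_contra hx'
    have h1 : f x = 0 := by
      by_contra h2
      exact hx' (hfT h2)
    rw [Set.mem_Icc, ← abs_le, not_le] at hx'
    refine hx ?_
    dsimp only
    rw [h1, h.dyadic_mother_eq_zero hk (by linarith), mul_zero, zero_add]
  · refine (h.besovJ_add_le s hp hq hfi ((h.integrable_dyadic_mother j k).const_mul _)).trans ?_
    refine le_trans ?_ hδ
    gcongr
    refine (besovJ_smul_le _ _ _ _ _ _ _).trans ?_
    refine (mul_le_mul_right (h.besovJ_dyadic_le s p q j k) _).trans ?_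
    rw [Real.enorm_of_nonneg hγ0, ← ENNReal.ofReal_mul hγ0, hγ, mul_assoc, ← Real.rpow_add two_pos,
      neg_add_cancel, Real.rpow_zero, mul_one]
    exact ENNReal.ofReal_le_ofReal hc1

/-- Separation of the perturbations by wavelets with disjoint supports. -/
lemma le_lintegral_sub_rpow (h : IsBoundedPair N φ ψ A B)
    {r : ℝ} (hr : 1 ≤ r) (f : ℝ → ℝ) {γ : ℝ} (hγ : 0 ≤ γ) (j : ℕ) {k l : ℤ}
    (hkl : 2 * A < |(k : ℝ) - l|) :
    ENNReal.ofReal (γ ^ r * ((2 : ℝ) ^ ((j : ℝ) * (r / 2 - 1)) * ∫ x, |ψ x| ^ r)) ≤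
      ∫⁻ x, ENNReal.ofReal (|(f x + γ * dyadic ψ j k x) - (f x + γ * dyadic ψ j l x)| ^ r) := by
  rw [← integral_abs_dyadic_rpow ψ j k r, ← integral_const_mul, ofReal_integral_eq_lintegral_ofReal
    ((h.integrable_abs_dyadic_rpow j k hr).const_mul _)
    (Filter.Eventually.of_forall fun x => by positivity)]
  refine lintegral_mono fun x => ENNReal.ofReal_le_ofReal ?_
  rw [← Real.mul_rpow hγ (abs_nonneg _)]
  refine Real.rpow_le_rpow (by positivity) ?_ (by linarith)
  rw [add_sub_add_left_eq_sub, ← mul_sub, abs_mul, abs_of_nonneg hγ]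
  refine mul_le_mul_of_nonneg_left ?_ hγ
  by_cases hx : A < |(2 : ℝ) ^ (j : ℤ) * x - k|
  · have : dyadic ψ j k x = 0 := by rw [dyadic, h.mother_zero _ hx, mul_zero]
    simp [this]
  · have h1 : A < |(2 : ℝ) ^ (j : ℤ) * x - l| := by
      have h2 := abs_sub_le (k : ℝ) ((2 : ℝ) ^ (j : ℤ) * x) l
      rw [abs_sub_comm (k : ℝ) ((2 : ℝ) ^ (j : ℤ) * x)] at h2
      linarith
    have : dyadic ψ j l x = 0 := by rw [dyadic, h.mother_zero _ h1, mul_zero]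
    simp [this]

end IsBoundedPair

/-! ### Second moments of likelihood ratios -/

lemma lintegral_mul_sq_le {Ω : Type*} [MeasurableSpace Ω] (μ : Measure Ω) {f g : Ω → ℝ≥0∞}
    (hf : AEMeasurable f μ) (hg : AEMeasurable g μ) :
    (∫⁻ x, f x * g x ∂μ) ^ 2 ≤ (∫⁻ x, f x ^ 2 ∂μ) * ∫⁻ x, g x ^ 2 ∂μ := by
  have h := ENNReal.lintegral_mul_le_Lp_mul_Lq μ Real.HolderConjugate.two_two hf hg
  simp only [Pi.mul_apply, ENNReal.rpow_two] at h
  refine (pow_le_pow_left₀ (zero_le) h 2).trans (le_of_eq ?_)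
  rw [mul_pow, ← ENNReal.rpow_two, ← ENNReal.rpow_two, ← ENNReal.rpow_mul, ← ENNReal.rpow_mul]
  simp

/-- If the likelihood ratio of `P` with respect to `ν` deviates from `1` by at most `t`, its second
moment is at most `1 + t²`. -/
lemma sq_lintegral_le_of_abs_sub_le {Ω : Type*} [MeasurableSpace Ω] (P ν : Measure Ω)
    [IsProbabilityMeasure P] [IsProbabilityMeasure ν] {t : ℝ} (ht : 0 ≤ t)
    (h : ∀ s, MeasurableSet s → |P.real s - ν.real s| ≤ t * ν.real s) {u : Ω → ℝ≥0∞}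
    (hu : Measurable u) :
    (∫⁻ x, u x ∂P) ^ 2 ≤ ENNReal.ofReal (1 + t ^ 2) * ∫⁻ x, u x ^ 2 ∂ν := by
  have hac : P ≪ ν := by
    refine Measure.AbsolutelyContinuous.mk fun s hs h0 => ?_
    have h1 := h s hs
    have h2 : ν.real s = 0 := by simp [Measure.real, h0]
    rw [h2, mul_zero, sub_zero] at h1
    have h3 : P.real s = 0 := abs_nonpos_iff.1 h1
    rwa [measureReal_eq_zero_iff] at h3
  set ρ := P.rnDeriv ν with hρ
  have hρm : Measurable ρ := Measure.measurable_rnDeriv P ν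
  have hset : ∀ s, ∫⁻ x in s, ρ x ∂ν = P s := fun s => Measure.setLIntegral_rnDeriv hac s
  have hup : ∀ᵐ x ∂ν, ρ x ≤ ENNReal.ofReal (1 + t) := by
    refine ae_le_of_forall_setLIntegral_le_of_sigmaFinite hρm fun s hs _ => ?_
    rw [hset, setLIntegral_const, ← ofReal_measureReal, ← ofReal_measureReal (μ := ν),
      ← ENNReal.ofReal_mul (by positivity)]
    refine ENNReal.ofReal_le_ofReal ?_
    have := (abs_le.1 (h s hs)).2
    linarith
  have hlow : ∀ᵐ x ∂ν, 1 ≤ ρ x + ENNReal.ofReal t := by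
    refine ae_le_of_forall_setLIntegral_le_of_sigmaFinite measurable_const fun s hs _ => ?_
    rw [lintegral_add_left hρm, hset, setLIntegral_const, setLIntegral_const, one_mul,
      ← ofReal_measureReal, ← ofReal_measureReal (μ := P), ← ENNReal.ofReal_mul ht,
      ← ENNReal.ofReal_add (by positivity) (by positivity)]
    refine ENNReal.ofReal_le_ofReal ?_
    have := (abs_le.1 (h s hs)).1
    linarith
  -- This is `(ρ - 1)² ≤ t²` expanded. Integrating it with `∫ ρ dν = 1` gives the second moment
  -- bound `1 + t²`, and Cauchy–Schwarz then finishes.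
  have hR : ∀ᵐ x ∂ν, (ρ x).toReal ^ 2 ≤ 2 * (ρ x).toReal - 1 + t ^ 2 ∧
      ρ x = ENNReal.ofReal (ρ x).toReal := by
    filter_upwards [hup, hlow] with x h1 h2
    have hfin : ρ x ≠ ∞ := (h1.trans_lt ENNReal.ofReal_lt_top).ne
    have e := ENNReal.ofReal_toReal hfin
    refine ⟨?_, e.symm⟩
    have h0 : 0 ≤ (ρ x).toReal := ENNReal.toReal_nonneg
    rw [← e] at h1 h2
    rw [ENNReal.ofReal_le_ofReal_iff (by positivity)] at h1
    rw [← ENNReal.ofReal_add h0 ht, ← ENNReal.ofReal_one,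
      ENNReal.ofReal_le_ofReal_iff (by positivity)] at h2
    nlinarith
  have hint : Integrable (fun x => (ρ x).toReal) ν := Measure.integrable_toReal_rnDeriv
  have hsq : ∫⁻ x, ρ x ^ 2 ∂ν ≤ ENNReal.ofReal (1 + t ^ 2) := by
    have h1 : ∫⁻ x, ρ x ^ 2 ∂ν ≤ ∫⁻ x, ENNReal.ofReal (2 * (ρ x).toReal - 1 + t ^ 2) ∂ν := by
      refine lintegral_mono_ae (hR.mono fun x hx => ?_)
      rw [hx.2, ← ENNReal.ofReal_pow ENNReal.toReal_nonneg, ENNReal.toReal_ofReal ENNReal.toReal_nonneg]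
      exact ENNReal.ofReal_le_ofReal hx.1
    refine h1.trans (le_of_eq ?_)
    have hi : Integrable (fun x => 2 * (ρ x).toReal - 1 + t ^ 2) ν :=
      ((hint.const_mul 2).sub (integrable_const 1)).add (integrable_const (t ^ 2))
    rw [← ofReal_integral_eq_lintegral_ofReal hi
      (hR.mono fun x hx => (sq_nonneg _).trans hx.1)]
    congr 1
    rw [integral_add (f := fun x => 2 * (ρ x).toReal - 1)
      ((hint.const_mul 2).sub (integrable_const 1)) (integrable_const (t ^ 2)),
      integral_sub (hint.const_mul 2) (integrable_const 1), integral_const_mul,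
      Measure.integral_toReal_rnDeriv hac]
    simp
    ring
  rw [← lintegral_rnDeriv_mul hac hu.aemeasurable]
  refine (lintegral_mul_sq_le ν hρm.aemeasurable hu.aemeasurable).trans ?_
  gcongr

/-! ### Densities and private releases -/

/-- A probability density with respect to Lebesgue measure. -/
structure IsDensity (f : ℝ → ℝ) : Prop where
  nonneg : ∀ x, 0 ≤ f x
  integrable : Integrable f
  integral_eq : ∫ x, f x = 1

/-- The measure on the line with density `f`. -/
noncomputable abbrev densityMeasure (f : ℝ → ℝ) : Measure ℝ :=
  (volume : Measure ℝ).withDensity fun x => ENNReal.ofReal (f x)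

lemma IsDensity.isProbabilityMeasure {f : ℝ → ℝ} (hf : IsDensity f) :
    IsProbabilityMeasure (densityMeasure f) := by
  constructor
  rw [withDensity_apply _ MeasurableSet.univ, Measure.restrict_univ,
    ← ofReal_integral_eq_lintegral_ofReal hf.integrable (Filter.Eventually.of_forall hf.nonneg),
    hf.integral_eq, ENNReal.ofReal_one]

/-! ### A single private release. -/

section OneStep

variable {Z : Type*} [MeasurableSpace Z]

lemma real_bind_densityMeasure (κ : Kernel ℝ Z) [IsMarkovKernel κ] {f : ℝ → ℝ} (hf : IsDensity f)
    {s : Set Z} (hs : MeasurableSet s) :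
    ((densityMeasure f).bind κ).real s = ∫ x, (κ x).real s * f x := by
  have hm : Measurable fun x => κ x s := κ.measurable_coe hs
  have hi : Integrable (fun x => (κ x).real s * f x) :=
    hf.integrable.bdd_mul (c := 1) hm.ennreal_toReal.aestronglyMeasurable
      (Filter.Eventually.of_forall fun x => by
        rw [Real.norm_of_nonneg measureReal_nonneg]; exact measureReal_le_one)
  have h0 : ∀ x, 0 ≤ (κ x).real s * f x := fun x => mul_nonneg measureReal_nonneg (hf.nonneg x)
  rw [Measure.real, Measure.bind_apply hs κ.aemeasurable,
    lintegral_withDensity_eq_lintegral_mul₀ hf.integrable.aemeasurable.ennreal_ofReal hm.aemeasurable,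
    integral_eq_lintegral_of_nonneg_ae (Filter.Eventually.of_forall h0) hi.aestronglyMeasurable]
  congr 1
  refine lintegral_congr fun x => ?_
  rw [Pi.mul_apply, ENNReal.ofReal_mul measureReal_nonneg, ofReal_measureReal, mul_comm]

/-- Privatization contracts the total variation distance: the marginal likelihood ratio deviates
from `1` by at most `(e^α - 1) ‖f - f₀‖₁`. -/
lemma abs_real_bind_sub_le (κ : Kernel ℝ Z) [IsMarkovKernel κ] {α : ℝ} (hα : 0 ≤ α)
    (hκ : ∀ (x x' : ℝ) (s : Set Z), MeasurableSet s →
      κ x s ≤ ENNReal.ofReal (Real.exp α) * κ x' s)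
    {f f₀ : ℝ → ℝ} (hf : IsDensity f) (hf₀ : IsDensity f₀) {τ : ℝ} (hτ : ∫ x, |f x - f₀ x| ≤ τ)
    {s : Set Z} (hs : MeasurableSet s) :
    |((densityMeasure f).bind κ).real s - ((densityMeasure f₀).bind κ).real s| ≤
      (Real.exp α - 1) * τ * ((densityMeasure f₀).bind κ).real s := by
  rw [real_bind_densityMeasure κ hf hs, real_bind_densityMeasure κ hf₀ hs]
  set a : ℝ → ℝ := fun x => (κ x).real s with ha
  have hm : Measurable a := (κ.measurable_coe hs).ennreal_toReal
  have ha0 : ∀ x, 0 ≤ a x := fun x => measureReal_nonneg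
  have hi : ∀ {g : ℝ → ℝ}, Integrable g → Integrable (fun x => a x * g x) := fun hg =>
    hg.bdd_mul (c := 1) hm.aestronglyMeasurable (Filter.Eventually.of_forall fun x => by
        rw [Real.norm_of_nonneg measureReal_nonneg]; exact measureReal_le_one)
  have hax : ∀ x y, a x ≤ Real.exp α * a y := by
    intro x y
    have h1 := ENNReal.toReal_mono (by finiteness) (hκ x y s hs)
    rwa [ENNReal.toReal_mul, ENNReal.toReal_ofReal (Real.exp_pos α).le] at h1
  -- Subtracting the constant `m` from `a` changes nothing, as `f - f₀` has integral zero. Privacy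
  -- then gives `0 ≤ a - m ≤ (e^α - 1) m`, and `m` is at most the `f₀`-average of `a`, which makes
  -- the bound relative to that average.
  set m := ⨅ x, a x with hmdef
  have hbdd : BddBelow (Set.range a) := ⟨0, by rintro _ ⟨x, rfl⟩; exact ha0 x⟩
  have hm0 : 0 ≤ m := le_ciInf ha0
  have hma : ∀ x, m ≤ a x := fun x => ciInf_le hbdd x
  have ham : ∀ x, a x ≤ Real.exp α * m := by
    intro x
    rw [← div_le_iff₀' (Real.exp_pos α)]
    refine le_ciInf fun y => ?_
    rw [div_le_iff₀' (Real.exp_pos α)]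
    exact hax x y
  have hmf : m ≤ ∫ x, a x * f₀ x := by
    have h1 : ∫ x, m * f₀ x = m := by rw [integral_const_mul, hf₀.integral_eq, mul_one]
    rw [← h1]
    exact integral_mono (hf₀.integrable.const_mul m) (hi hf₀.integrable) fun x =>
      mul_le_mul_of_nonneg_right (hma x) (hf₀.nonneg x)
  have hdi : Integrable (fun x => f x - f₀ x) := hf.integrable.sub hf₀.integrable
  have hdiff : (∫ x, a x * f x) - ∫ x, a x * f₀ x = ∫ x, (a x - m) * (f x - f₀ x) := by
    have h1 : ∫ x, m * (f x - f₀ x) = 0 := by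
      rw [integral_const_mul, integral_sub hf.integrable hf₀.integrable, hf.integral_eq,
        hf₀.integral_eq, sub_self, mul_zero]
    simp_rw [sub_mul]
    rw [integral_sub (hi hdi) (hdi.const_mul m), h1, sub_zero,
      ← integral_sub (hi hf.integrable) (hi hf₀.integrable)]
    simp_rw [mul_sub]
  have he : 0 ≤ Real.exp α - 1 := sub_nonneg.2 (Real.one_le_exp hα)
  have hτ0 : 0 ≤ τ := (integral_nonneg fun _ => abs_nonneg _).trans hτ
  rw [hdiff]
  have hI0 : 0 ≤ (Real.exp α - 1) * ∫ x, a x * f₀ x := mul_nonneg he (hm0.trans hmf)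
  calc |∫ x, (a x - m) * (f x - f₀ x)|
      ≤ ∫ x, (Real.exp α - 1) * m * |f x - f₀ x| := by
        refine abs_integral_le_integral_abs.trans (integral_mono_of_nonneg
          (Filter.Eventually.of_forall fun _ => abs_nonneg _) (hdi.abs.const_mul _)
          (Filter.Eventually.of_forall fun x => ?_))
        dsimp only
        rw [abs_mul, abs_of_nonneg (sub_nonneg.2 (hma x))]
        refine mul_le_mul_of_nonneg_right ?_ (abs_nonneg _)
        linarith [ham x]
    _ = (Real.exp α - 1) * m * ∫ x, |f x - f₀ x| := integral_const_mul _ _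
    _ ≤ (Real.exp α - 1) * (∫ x, a x * f₀ x) * τ :=
        mul_le_mul (mul_le_mul_of_nonneg_left hmf he) hτ (integral_nonneg fun _ => abs_nonneg _) hI0
    _ = _ := by ring

end OneStep

/-! ### Sequences of `n` interactive releases. -/

section Release

variable {Z : Type*} [MeasurableSpace Z]

lemma measurable_snoc (n : ℕ) :
    Measurable fun w : (Fin n → Z) × Z => (Fin.snoc w.1 w.2 : Fin (n + 1) → Z) := by
  refine measurable_pi_lambda _ fun i => ?_
  refine Fin.lastCases ?_ (fun i => ?_) i
  · simpa using measurable_snd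
  · simp only [Fin.snoc_castSucc]
    exact (measurable_pi_apply i).comp measurable_fst

lemma isMarkovKernel_release (Q : (i : ℕ) → Kernel ((Fin i → Z) × ℝ) Z)
    (hQ : ∀ i, IsMarkovKernel (Q i)) (n : ℕ) : IsMarkovKernel (release Q n) := by
  induction n with
  | zero =>
    rw [release]
    infer_instance
  | succ n ih =>
    have := hQ n
    rw [release]
    exact Kernel.IsMarkovKernel.map _ (measurable_snoc n)

variable (Q : (i : ℕ) → Kernel ((Fin i → Z) × ℝ) Z)

lemma lintegral_privateLaw_zero {f : ℝ → ℝ} (hf : IsDensity f) {u : (Fin 0 → Z) → ℝ≥0∞}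
    (hu : Measurable u) : ∫⁻ z, u z ∂(privateLaw Q 0 f) = u Fin.elim0 := by
  have := hf.isProbabilityMeasure
  rw [privateLaw, Measure.lintegral_bind (release Q 0).aemeasurable hu.aemeasurable]
  simp [release, lintegral_dirac' _ hu]

/-- The new observation is independent of all earlier ones, hence of the past releases, so it can be
averaged out conditionally on them. This gives the law of the releases a one-step recursion and
makes induction on `n` possible. -/
lemma lintegral_privateLaw_succ (hQ : ∀ i, IsMarkovKernel (Q i)) {f : ℝ → ℝ} (hf : IsDensity f)
    (n : ℕ) {u : (Fin (n + 1) → Z) → ℝ≥0∞} (hu : Measurable u) :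
    ∫⁻ z, u z ∂(privateLaw Q (n + 1) f) =
      ∫⁻ z, ∫⁻ y, ∫⁻ w, u (Fin.snoc z w) ∂(Q n (z, y)) ∂(densityMeasure f) ∂(privateLaw Q n f) := by
  have := hf.isProbabilityMeasure
  have hmark := isMarkovKernel_release Q hQ n
  have hQn := hQ n
  have hH : Measurable fun zy : (Fin n → Z) × ℝ => ∫⁻ w, u (Fin.snoc zy.1 w) ∂(Q n zy) := by
    refine Measurable.lintegral_kernel_prod_right' (κ := Q n)
      (f := fun v : ((Fin n → Z) × ℝ) × Z => u (Fin.snoc v.1.1 v.2)) ?_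
    exact hu.comp ((measurable_snoc n).comp (by fun_prop : Measurable
      fun v : ((Fin n → Z) × ℝ) × Z => (v.1.1, v.2)))
  have hG : Measurable fun yx : ℝ × (Fin n → ℝ) =>
      ∫⁻ z, ∫⁻ w, u (Fin.snoc z w) ∂(Q n (z, yx.1)) ∂(release Q n yx.2) := by
    refine Measurable.lintegral_kernel_prod_right' (κ := (release Q n).comap Prod.snd measurable_snd)
      (f := fun v : (ℝ × (Fin n → ℝ)) × (Fin n → Z) => ∫⁻ w, u (Fin.snoc v.2 w) ∂(Q n (v.2, v.1.1))) ?_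
    exact hH.comp (by fun_prop : Measurable
      fun v : (ℝ × (Fin n → ℝ)) × (Fin n → Z) => (v.2, v.1.1))
  have hrel : ∀ x : Fin (n + 1) → ℝ, ∫⁻ z, u z ∂(release Q (n + 1) x) =
      ∫⁻ z, ∫⁻ w, u (Fin.snoc z w) ∂(Q n (z, x (Fin.last n))) ∂(release Q n fun i => x i.castSucc) := by
    intro x
    rw [release, Kernel.lintegral_map _ (measurable_snoc n) _ hu,
      Kernel.lintegral_compProd _ _ _ (f := fun w => u (Fin.snoc w.1 w.2))
        (hu.comp (measurable_snoc n))]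
    simp only [Kernel.comap_apply]
  rw [privateLaw, Measure.lintegral_bind (release Q (n + 1)).aemeasurable hu.aemeasurable]
  simp_rw [hrel]
  -- The last observation is split off the product measure; exchanging it with the earlier releases
  -- is then Tonelli's theorem.
  have hmp := measurePreserving_piFinSuccAbove (fun _ : Fin (n + 1) => densityMeasure f) (Fin.last n)
  have h1 := hmp.lintegral_comp hG
  have h2 : ∀ x : Fin (n + 1) → ℝ, (fun yx : ℝ × (Fin n → ℝ) =>
      ∫⁻ z, ∫⁻ w, u (Fin.snoc z w) ∂(Q n (z, yx.1)) ∂(release Q n yx.2))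
        (MeasurableEquiv.piFinSuccAbove (fun _ => ℝ) (Fin.last n) x) =
      ∫⁻ z, ∫⁻ w, u (Fin.snoc z w) ∂(Q n (z, x (Fin.last n))) ∂(release Q n fun i => x i.castSucc) := by
    intro x
    have e : (MeasurableEquiv.piFinSuccAbove (fun _ => ℝ) (Fin.last n) x) =
        (x (Fin.last n), fun i => x i.castSucc) := by
      ext i
      · rfl
      · simp [MeasurableEquiv.piFinSuccAbove, Fin.init]
    rw [e]
  have h3 : ∫⁻ x, ∫⁻ z, ∫⁻ w, u (Fin.snoc z w) ∂(Q n (z, x (Fin.last n)))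
      ∂(release Q n fun i => x i.castSucc) ∂(Measure.pi fun _ : Fin (n + 1) => densityMeasure f) =
      ∫⁻ yx : ℝ × (Fin n → ℝ), ∫⁻ z, ∫⁻ w, u (Fin.snoc z w) ∂(Q n (z, yx.1)) ∂(release Q n yx.2)
        ∂((densityMeasure f).prod (Measure.pi fun _ : Fin n => densityMeasure f)) := by
    rw [← h1]
    exact lintegral_congr fun x => (h2 x).symm
  rw [h3, lintegral_prod_symm' _ hG, privateLaw, Measure.lintegral_bind (release Q n).aemeasurable
    (Measurable.lintegral_prod_right' (f := fun v : (Fin n → Z) × ℝ =>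
      ∫⁻ w, u (Fin.snoc v.1 w) ∂(Q n (v.1, v.2))) hH).aemeasurable]
  refine lintegral_congr fun x => ?_
  exact lintegral_lintegral_swap (μ := densityMeasure f) (ν := release Q n x)
    (f := fun y z => ∫⁻ w, u (Fin.snoc z w) ∂(Q n (z, y)))
    (hH.comp measurable_swap).aemeasurable

/-- The second moment of the likelihood ratio of the private samples. -/
lemma sq_lintegral_privateLaw_le {α : ℝ} (hα : 0 ≤ α) (M : PrivateMechanism α Z) {f f₀ : ℝ → ℝ}
    (hf : IsDensity f) (hf₀ : IsDensity f₀) {τ : ℝ} (hτ : ∫ x, |f x - f₀ x| ≤ τ) (n : ℕ)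
    {u : (Fin n → Z) → ℝ≥0∞} (hu : Measurable u) :
    (∫⁻ z, u z ∂(privateLaw M.Q n f)) ^ 2 ≤
      ENNReal.ofReal (1 + ((Real.exp α - 1) * τ) ^ 2) ^ n *
        ∫⁻ z, u z ^ 2 ∂(privateLaw M.Q n f₀) := by
  induction n with
  | zero =>
    rw [lintegral_privateLaw_zero _ hf hu, lintegral_privateLaw_zero _ hf₀ (hu.pow_const 2), pow_zero,
      one_mul]
  | succ n ih =>
    have hQn := M.markov n
    have := hf.isProbabilityMeasure
    have := hf₀.isProbabilityMeasure
    have hH : ∀ {v : (Fin (n + 1) → Z) → ℝ≥0∞}, Measurable v → ∀ f : ℝ → ℝ,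
        IsProbabilityMeasure (densityMeasure f) → Measurable fun z : Fin n → Z =>
        ∫⁻ y, ∫⁻ w, v (Fin.snoc z w) ∂(M.Q n (z, y)) ∂(densityMeasure f) := by
      intro v hv f _
      refine Measurable.lintegral_prod_right' (f := fun a : (Fin n → Z) × ℝ =>
        ∫⁻ w, v (Fin.snoc a.1 w) ∂(M.Q n (a.1, a.2))) ?_
      refine Measurable.lintegral_kernel_prod_right' (κ := M.Q n)
        (f := fun v' : ((Fin n → Z) × ℝ) × Z => v (Fin.snoc v'.1.1 v'.2)) ?_
      exact hv.comp ((measurable_snoc n).comp (by fun_prop : Measurable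
        fun v' : ((Fin n → Z) × ℝ) × Z => (v'.1.1, v'.2)))
    have hτ0 : 0 ≤ τ := (integral_nonneg fun _ => abs_nonneg _).trans hτ
    have ht : 0 ≤ (Real.exp α - 1) * τ := mul_nonneg (sub_nonneg.2 (Real.one_le_exp hα)) hτ0
    rw [lintegral_privateLaw_succ M.Q M.markov hf n hu,
      lintegral_privateLaw_succ M.Q M.markov hf₀ n (hu.pow_const 2)]
    -- The induction hypothesis is applied to the conditional mean of `u` given the first `n`
    -- releases. It remains to bound the square of this mean for each fixed past `z`, where the
    -- mechanism is an ordinary private kernel.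
    refine (ih (hH hu f inferInstance)).trans ?_
    rw [pow_succ (ENNReal.ofReal _) n, mul_assoc]
    gcongr
    rw [← lintegral_const_mul _ (hH (hu.pow_const 2) f₀ inferInstance)]
    refine lintegral_mono fun z => ?_
    set κ : Kernel ℝ Z := (M.Q n).comap (fun y => (z, y)) (by fun_prop) with hκ
    have hk : ∀ (f : ℝ → ℝ) {v : (Fin (n + 1) → Z) → ℝ≥0∞}, Measurable v →
        ∫⁻ y, ∫⁻ w, v (Fin.snoc z w) ∂(M.Q n (z, y)) ∂(densityMeasure f) =
        ∫⁻ w, v (Fin.snoc z w) ∂((densityMeasure f).bind κ) := by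
      intro f v hv
      have hm : Measurable fun w => v (Fin.snoc z w) :=
        hv.comp ((measurable_snoc n).comp measurable_prodMk_left)
      rw [Measure.lintegral_bind κ.aemeasurable hm.aemeasurable]
      rfl
    dsimp only
    rw [hk f hu, hk f₀ (hu.pow_const 2)]
    have hb : ∀ f : ℝ → ℝ, IsProbabilityMeasure (densityMeasure f) →
        IsProbabilityMeasure ((densityMeasure f).bind κ) := fun f _ => inferInstance
    have := hb f inferInstance
    have := hb f₀ inferInstance
    exact sq_lintegral_le_of_abs_sub_le _ _ ht (fun s hs => abs_real_bind_sub_le κ hα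
      (fun x x' s hs => M.isPrivate n z x x' s hs) hf hf₀ hτ hs)
      (hu.comp ((measurable_snoc n).comp measurable_prodMk_left))

lemma isProbabilityMeasure_privateLaw (hQ : ∀ i, IsMarkovKernel (Q i)) {f : ℝ → ℝ}
    (hf : IsDensity f) (n : ℕ) : IsProbabilityMeasure (privateLaw Q n f) := by
  have := hf.isProbabilityMeasure
  have := isMarkovKernel_release Q hQ n
  rw [privateLaw]
  infer_instance

end Release

/-! ### Reduction to a multiple testing problem -/

lemma ofReal_abs_sub_rpow_le {r : ℝ} (hr : 1 ≤ r) (a b c : ℝ) :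
    ENNReal.ofReal (|a - b| ^ r) ≤ ENNReal.ofReal (2 ^ (r - 1)) *
      (ENNReal.ofReal (|c - a| ^ r) + ENNReal.ofReal (|c - b| ^ r)) := by
  have hr0 : 0 ≤ r := by linarith
  rw [← ENNReal.ofReal_rpow_of_nonneg (abs_nonneg _) hr0,
    ← ENNReal.ofReal_rpow_of_nonneg (abs_nonneg _) hr0,
    ← ENNReal.ofReal_rpow_of_nonneg (abs_nonneg _) hr0, ← ENNReal.ofReal_rpow_of_pos two_pos,
    ENNReal.ofReal_ofNat]
  refine le_trans ?_ (ENNReal.rpow_add_le_mul_rpow_add_rpow _ _ hr)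
  refine ENNReal.rpow_le_rpow ?_ hr0
  rw [← ENNReal.ofReal_add (abs_nonneg _) (abs_nonneg _), abs_sub_comm c a]
  exact ENNReal.ofReal_le_ofReal (abs_sub_le a c b)

/-- If finitely many measures have likelihood ratios with second moment at most `K` with respect to a
common probability measure, then among `4 K` disjoint events one has probability at most `1 / 2`. -/
lemma exists_real_le_half {Ω : Type*} [MeasurableSpace Ω] {m : ℕ} (hm : 0 < m) (P : Fin m → Measure Ω)
    [∀ i, IsProbabilityMeasure (P i)] (ν : Measure Ω) [IsProbabilityMeasure ν] {K : ℝ} (hK : 0 ≤ K)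
    (h : ∀ i s, MeasurableSet s → P i s ^ 2 ≤ ENNReal.ofReal K * ν s) (hKm : 4 * K ≤ m)
    {E : Fin m → Set Ω} (hE : ∀ i, MeasurableSet (E i)) (hd : Pairwise (Function.onFun Disjoint E)) :
    ∃ i, (P i).real (E i) ≤ 1 / 2 := by
  by_contra! hcon
  have h1 : ∀ i, (P i).real (E i) ^ 2 ≤ K * ν.real (E i) := by
    intro i
    have h2 := ENNReal.toReal_mono (by finiteness) (h i (E i) (hE i))
    rwa [ENNReal.toReal_pow, ENNReal.toReal_mul, ENNReal.toReal_ofReal hK] at h2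
  have h3 : ∑ i, ν.real (E i) ≤ 1 := by
    have := sum_measureReal_le_measureReal_univ (μ := ν) (s := Finset.univ) (t := E)
      (fun i _ => hE i) (fun i _ l _ hil => hd hil)
    simpa using this
  -- If every probability exceeded `1/2`, each `K ν(E i)` would exceed `1/4`. Disjointness bounds
  -- their sum by `K`, so `m / 4 < K`, contradicting `4 K ≤ m`.
  have h4 : ∑ _i : Fin m, (1 / 4 : ℝ) < ∑ i, K * ν.real (E i) := by
    have : Nonempty (Fin m) := ⟨⟨0, hm⟩⟩
    refine Finset.sum_lt_sum_of_nonempty Finset.univ_nonempty fun i _ => ?_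
    refine lt_of_lt_of_le ?_ (h1 i)
    have := hcon i
    nlinarith
  rw [← Finset.mul_sum, Finset.sum_const, Finset.card_univ, Fintype.card_fin, nsmul_eq_mul] at h4
  have := mul_le_mul_of_nonneg_left h3 hK
  linarith

/-- An integrable density is only almost everywhere measurable; replacing it by a measurable version
does not change the inner integral. -/
lemma measurable_lintegral_estimator {n : ℕ} {Z : Type*} [MeasurableSpace Z] (g : Estimator n Z)
    {f : ℝ → ℝ} (hf : AEMeasurable f) (r : ℝ) :
    Measurable fun z => ∫⁻ x, ENNReal.ofReal (|g.1 z x - f x| ^ r) := by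
  have h : (fun z => ∫⁻ x, ENNReal.ofReal (|g.1 z x - f x| ^ r)) =
      fun z => ∫⁻ x, ENNReal.ofReal (|g.1 z x - hf.mk f x| ^ r) := by
    funext z
    refine lintegral_congr_ae ?_
    filter_upwards [hf.ae_eq_mk] with x hx
    rw [hx]
  rw [h]
  refine Measurable.lintegral_prod_right'
    (f := fun v : (Fin n → Z) × ℝ => ENNReal.ofReal (|g.1 v.1 v.2 - hf.mk f v.2| ^ r)) ?_
  have h1 : Measurable fun v : (Fin n → Z) × ℝ => g.1 v.1 v.2 := g.2
  have h2 : Measurable fun v : (Fin n → Z) × ℝ => hf.mk f v.2 := hf.measurable_mk.comp measurable_snd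
  exact ((h1.sub h2).abs.pow_const r).ennreal_ofReal

/-- A lower bound for the private minimax risk from a family of separated densities which are close
to a common density in total variation. -/
lemma le_privateMinimaxRisk {r α Δ τ : ℝ} (hr : 1 ≤ r) (hα : 0 ≤ α) (hΔ : 0 < Δ) {m n : ℕ}
    (hm : 0 < m) {F : Set (ℝ → ℝ)} {f₀ : ℝ → ℝ} (hf₀ : IsDensity f₀) {f : Fin m → ℝ → ℝ}
    (hf : ∀ i, IsDensity (f i)) (hF : ∀ i, f i ∈ F) (hτ : ∀ i, ∫ x, |f i x - f₀ x| ≤ τ)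
    (hsep : ∀ i l, i ≠ l → ENNReal.ofReal Δ ≤ ∫⁻ x, ENNReal.ofReal (|f i x - f l x| ^ r))
    (hK : 4 * (1 + ((Real.exp α - 1) * τ) ^ 2) ^ n ≤ m) :
    ENNReal.ofReal (Δ * 2 ^ (-(r + 1))) ≤ privateMinimaxRisk.{u} r n α F := by
  refine le_iInf fun Z => le_iInf fun _ => le_iInf fun M => le_iInf fun g => ?_
  have hprob := fun i => isProbabilityMeasure_privateLaw M.Q M.markov (hf i) n
  have hprob₀ := isProbabilityMeasure_privateLaw M.Q M.markov hf₀ n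
  set d : Fin m → (Fin n → Z) → ℝ≥0∞ := fun i z => ∫⁻ x, ENNReal.ofReal (|g.1 z x - f i x| ^ r) with hd
  have hdm : ∀ i, Measurable (d i) := fun i =>
    measurable_lintegral_estimator g (hf i).integrable.aemeasurable r
  -- Chosen so that `2^{r-1} (ε + ε) = Δ`: an estimate cannot be within `ε` of two different
  -- alternatives, so these events are disjoint.
  set ε : ℝ≥0∞ := ENNReal.ofReal (Δ * 2 ^ (-r)) with hε
  have hdisj : Pairwise (Function.onFun Disjoint fun i => {z | d i z < ε}) := by
    intro i l hil
    rw [Function.onFun, Set.disjoint_left]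
    intro z hi hl
    rw [Set.mem_ofPred_eq] at hi hl
    have h1 : ∫⁻ x, ENNReal.ofReal (|f i x - f l x| ^ r) ≤
        ENNReal.ofReal (2 ^ (r - 1)) * (d i z + d l z) := by
      have hmz : AEMeasurable (fun x => ENNReal.ofReal (|g.1 z x - f i x| ^ r)) := by
        have h2 : Measurable fun x => g.1 z x := g.2.comp measurable_prodMk_left
        exact ((h2.aemeasurable.sub (hf i).integrable.aemeasurable).abs.pow_const r).ennreal_ofReal
      rw [hd]
      dsimp only
      rw [← lintegral_add_left' hmz, ← lintegral_const_mul' _ _ ENNReal.ofReal_ne_top]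
      exact lintegral_mono fun x => ofReal_abs_sub_rpow_le hr _ _ _
    have h2 : ENNReal.ofReal (2 ^ (r - 1)) * (d i z + d l z) <
        ENNReal.ofReal (2 ^ (r - 1)) * (ε + ε) := by
      refine ENNReal.mul_lt_mul_right ?_ ENNReal.ofReal_ne_top (ENNReal.add_lt_add hi hl)
      rw [ENNReal.ofReal_ne_zero_iff]
      positivity
    have h3 : ENNReal.ofReal (2 ^ (r - 1)) * (ε + ε) = ENNReal.ofReal Δ := by
      rw [hε, ← ENNReal.ofReal_add (by positivity) (by positivity), ← ENNReal.ofReal_mul (by positivity)]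
      congr 1
      rw [Real.rpow_sub two_pos, Real.rpow_neg two_pos.le, Real.rpow_one]
      field_simp
      ring
    rw [h3] at h2
    exact absurd (hsep i l hil) (not_le.2 (h1.trans_lt h2))
  -- The second moment bound is used on indicators only, where it compares `P(s)²` with `ν(s)`. For
  -- the resulting `i`, Markov's inequality bounds the risk below by `ε / 2`.
  obtain ⟨i, hi⟩ := exists_real_le_half hm (fun i => privateLaw M.Q n (f i)) (privateLaw M.Q n f₀)
    (K := (1 + ((Real.exp α - 1) * τ) ^ 2) ^ n) (by positivity) (fun i s hs => by
      have := sq_lintegral_privateLaw_le hα M (hf i) hf₀ (hτ i) n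
        (u := s.indicator 1) (measurable_one.indicator hs)
      rw [lintegral_indicator_one hs, ← ENNReal.ofReal_pow (by positivity)] at this
      refine this.trans (le_of_eq ?_)
      congr 1
      rw [← lintegral_indicator_one hs]
      refine lintegral_congr fun z => ?_
      by_cases hz : z ∈ s <;> simp [hz]) hK
    (E := fun i => {z | d i z < ε}) (fun i => measurableSet_lt (hdm i) measurable_const) hdisj
  refine le_trans ?_ (le_iSup₂_of_le (f i) (hF i) le_rfl)
  refine le_trans ?_ (mul_meas_ge_le_lintegral (hdm i) ε)
  have hc : {z | ε ≤ d i z} = {z | d i z < ε}ᶜ := by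
    ext z; simp
  have h5 : ENNReal.ofReal (1 / 2) ≤ privateLaw M.Q n (f i) {z | ε ≤ d i z} := by
    rw [hc, ← ofReal_measureReal, probReal_compl_eq_one_sub (measurableSet_lt (hdm i) measurable_const)]
    refine ENNReal.ofReal_le_ofReal ?_
    linarith
  refine le_trans (le_of_eq ?_) (mul_le_mul_right h5 ε)
  rw [hε, ← ENNReal.ofReal_mul (by positivity), neg_add, Real.rpow_add two_pos, Real.rpow_neg_one]
  congr 1
  ring

/-! ### The lower bound -/

/-- The resolution level balancing separation against distinguishability. -/
lemma exists_level {D a G c : ℝ} (hD : 0 < D) (ha : 1 ≤ a) (hG : 0 < G) (hac : 4 * D * c ≤ a)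
    (hc : 0 ≤ c) :
    ∃ m₀ : ℝ, ∀ m : ℝ, m₀ ≤ m → 0 < Real.log m / m ∧ ∃ j : ℕ, G ≤ (2 : ℝ) ^ ((j : ℝ) / 2) ∧
      m * c * (2 : ℝ) ^ (-((j : ℝ) * D)) ≤ (j : ℝ) / 2 * Real.log 2 ∧
      (2 : ℝ) ^ ((j : ℝ) * D) ≤ 2 ^ D * a * (Real.log m / m)⁻¹ := by
  have h1 : ∀ᶠ m : ℝ in Filter.atTop, Real.log m ≤ m ^ (1 / 2 : ℝ) := by
    have := (isLittleO_log_rpow_atTop (r := 1 / 2) (by norm_num)).bound one_pos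
    filter_upwards [this, Filter.eventually_ge_atTop 0] with m hm hm0
    rw [one_mul, Real.norm_of_nonneg (Real.rpow_nonneg hm0 _)] at hm
    exact (le_abs_self _).trans hm
  -- Since `2^{j/2}` will be at least `m^{1/(4D)}`, this is what makes it exceed `G`; it also gives
  -- `log m ≥ 1`.
  have h2 : ∀ᶠ m : ℝ in Filter.atTop, 1 + 4 * D * |Real.log G| ≤ Real.log m :=
    Real.tendsto_log_atTop.eventually_ge_atTop _
  obtain ⟨m₀, hm₀⟩ := Filter.eventually_atTop.1 (h1.and (h2.and (Filter.eventually_gt_atTop 0)))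
  refine ⟨m₀, fun m hm => ?_⟩
  obtain ⟨hlog, hlogG, hmpos⟩ := hm₀ m hm
  have hlog2 : 0 < Real.log 2 := Real.log_pos one_lt_two
  have hl1 : 1 ≤ Real.log m := by
    have : 0 ≤ 4 * D * |Real.log G| := by positivity
    linarith
  have hlG : 4 * D * Real.log G ≤ Real.log m := by
    have : 4 * D * Real.log G ≤ 4 * D * |Real.log G| := by gcongr; exact le_abs_self _
    linarith
  have hl0 : 0 < Real.log m := by linarith
  set y := Real.log m / m with hy
  have hy0 : 0 < y := by positivity
  have hx : m ^ (1 / 2 : ℝ) ≤ a * y⁻¹ := by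
    have : m ^ (1 / 2 : ℝ) ≤ y⁻¹ := by
      rw [hy, inv_div, le_div_iff₀ hl0]
      calc m ^ (1 / 2 : ℝ) * Real.log m ≤ m ^ (1 / 2 : ℝ) * m ^ (1 / 2 : ℝ) := by gcongr
        _ = m := by rw [← Real.rpow_add hmpos]; norm_num
    exact this.trans (le_mul_of_one_le_left (by positivity) ha)
  have hloga : Real.log m / 2 ≤ Real.log (a * y⁻¹) := by
    have := Real.log_le_log (by positivity) hx
    rw [Real.log_rpow hmpos] at this
    linarith
  -- `v` is the real solution of `2^{vD} = a / y`, and `j = ⌈v⌉₊`. Rounding up helps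
  -- distinguishability and costs at most a factor `2^D` in the last bound.
  set v := Real.log (a * y⁻¹) / (Real.log 2 * D) with hv
  have hv0 : 0 ≤ v := by
    have : 0 ≤ Real.log (a * y⁻¹) := by linarith
    positivity
  have hexp : ∀ u : ℝ, (2 : ℝ) ^ (u * D) = Real.exp (u * (Real.log 2 * D)) := fun u => by
    rw [Real.rpow_def_of_pos two_pos]; ring_nf
  have hvD : (2 : ℝ) ^ (v * D) = a * y⁻¹ := by
    rw [hexp, hv, div_mul_cancel₀ _ (by positivity), Real.exp_log (by positivity)]
  have hj1 : v ≤ ⌈v⌉₊ := Nat.le_ceil v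
  have hj2 : (⌈v⌉₊ : ℝ) < v + 1 := Nat.ceil_lt_add_one hv0
  have hj3 : Real.log m / (4 * D) ≤ (⌈v⌉₊ : ℝ) / 2 * Real.log 2 := by
    have h3 : Real.log m / (4 * D) ≤ v / 2 * Real.log 2 := by
      have e : v / 2 * Real.log 2 = Real.log (a * y⁻¹) / (2 * D) := by
        rw [hv]; field_simp
      rw [e, div_le_div_iff₀ (by positivity) (by positivity)]
      nlinarith
    exact h3.trans (by gcongr)
  refine ⟨hy0, ⌈v⌉₊, ?_, ?_, ?_⟩
  · rw [Real.rpow_def_of_pos two_pos, mul_comm, ← Real.log_le_iff_le_exp hG]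
    refine le_trans ?_ hj3
    rw [le_div_iff₀ (by positivity)]
    linarith
  · refine le_trans ?_ hj3
    have h3 : (2 : ℝ) ^ (-((⌈v⌉₊ : ℝ) * D)) ≤ y / a := by
      rw [Real.rpow_neg two_pos.le, inv_le_comm₀ (by positivity) (by positivity), inv_div, div_eq_mul_inv,
        ← hvD]
      exact Real.rpow_le_rpow_of_exponent_le one_le_two (by gcongr)
    calc m * c * (2 : ℝ) ^ (-((⌈v⌉₊ : ℝ) * D)) ≤ m * c * (y / a) := by gcongr
      _ = Real.log m * (c / a) := by rw [hy]; field_simp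
      _ ≤ Real.log m * (1 / (4 * D)) := by
        refine mul_le_mul_of_nonneg_left ?_ hl0.le
        rw [div_le_div_iff₀ (by positivity) (by positivity)]
        linarith
      _ = Real.log m / (4 * D) := by ring
  · rw [mul_assoc, ← hvD, ← Real.rpow_add two_pos]
    refine Real.rpow_le_rpow_of_exponent_le one_le_two ?_
    nlinarith

namespace IsBoundedPair

variable {N : ℕ} {φ ψ : ℝ → ℝ} {A B : ℝ}

/-- The lower bound obtained from perturbations at a fixed resolution level. -/
lemma le_privateMinimaxRisk_of_level (h : IsBoundedPair N φ ψ A B)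
    {s : ℝ} {p q : ℝ≥0∞} {r L T : ℝ} (hp : 1 ≤ p) (hq : 1 ≤ q)
    (hr : 1 ≤ r) (hsp : (1 / p).toReal ≤ s) (hT : 0 < T) {f : ℝ → ℝ}
    (hf : f ∈ densityClass φ ψ s p q L T) {c δ c₁ : ℝ} (hc : ∀ x, |x| ≤ T / 2 → c ≤ f x)
    (hδ : besovJ φ ψ s p q f + ENNReal.ofReal δ ≤ ENNReal.ofReal L) (hc0 : 0 < c₁) (hc1 : c₁ ≤ δ)
    (hc2 : c₁ * B ≤ c) {S : ℕ} (hS : 2 * A < S) (j : ℕ) {α : ℝ} (hα : 0 ≤ α) (n : ℕ)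
    (hj : 1 + 4 * A / T + 32 * S / T ≤ (2 : ℝ) ^ ((j : ℝ) / 2))
    (hn : n * (Real.exp α - 1) ^ 2 * (c₁ * ∫ x, |ψ x|) ^ 2 *
      (2 : ℝ) ^ (-((j : ℝ) * (2 * (s - (1 / p).toReal) + 2))) ≤ (j : ℝ) / 2 * Real.log 2) :
    ENNReal.ofReal (c₁ ^ r * (∫ x, |ψ x| ^ r) *
      (2 : ℝ) ^ (-((j : ℝ) * (r * (s - (1 / p).toReal) + 1))) * 2 ^ (-(r + 1))) ≤
        privateMinimaxRisk.{u} r n α (densityClass φ ψ s p q L T) := by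
  have hA := h.pos
  have hS0 : (0 : ℝ) < S := by linarith
  set ip := (1 / p).toReal with hip
  set γ := c₁ * (2 : ℝ) ^ (-((j : ℝ) * (s + 1 / 2 - ip))) with hγ
  have hγ0 : 0 ≤ γ := by positivity
  have hw : (2 : ℝ) ^ (j : ℝ) = 2 ^ ((j : ℝ) / 2) * 2 ^ ((j : ℝ) / 2) := by
    rw [← Real.rpow_add two_pos]; congr 1; ring
  rw [Real.rpow_natCast] at hw
  set w := (2 : ℝ) ^ ((j : ℝ) / 2) with hwdef
  have hw1 : 1 ≤ w := by
    have h1 : 0 ≤ 4 * A / T := by positivity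
    have h2 : 0 ≤ 32 * S / T := by positivity
    linarith
  have hwS : 32 * S ≤ w * T := by
    have h1 : 0 ≤ 4 * A / T := by positivity
    rw [← div_le_iff₀ hT]; linarith
  have hwA : 4 * A ≤ w * T := by
    have h1 : 0 ≤ 32 * S / T := by positivity
    rw [← div_le_iff₀ hT]; linarith
  have hww : w * T ≤ w * w * T := by
    have : 0 ≤ (w - 1) * (w * T) := by
      have := sub_nonneg.2 hw1
      positivity
    nlinarith
  -- With `w² = 2^j`, these are about `2^j T / (4S)` shifts in steps of `S > 2A`. They reach at most
  -- `2^j T / 4`, and `A ≤ 2^j T / 4`, so all the wavelets are supported in `[-T/2, T/2]`.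
  set m := ⌊w * w * T / (4 * S)⌋₊ with hm
  have hm1 : (m : ℝ) ≤ w * w * T / (4 * S) := Nat.floor_le (by positivity)
  have hm2 : w * w * T / (4 * S) < m + 1 := Nat.lt_floor_add_one _
  have hm3 : (m : ℝ) * S ≤ w * w * T / 4 := by
    rw [le_div_iff₀ (by positivity)] at hm1
    linarith
  -- The number of alternatives grows like `w²` and the second moment will be at most `w`. The term
  -- `32 S / T` in the hypothesis on `j` gives `8 w < m + 1`, and `w ≥ 1` does the rest.
  have hm4 : 4 * w ≤ m := by
    rw [div_lt_iff₀ (by positivity)] at hm2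
    have h1 : 32 * S * w ≤ w * w * T := by nlinarith
    have h2 : 32 * S * w < (m + 1) * 4 * S := by linarith
    have h3 : 8 * w < m + 1 := by
      by_contra hcon
      have := mul_le_mul_of_nonneg_right (not_lt.1 hcon) hS0.le
      nlinarith
    linarith
  have hm0 : 0 < m := by
    have : (0 : ℝ) < m := by linarith
    exact_mod_cast this
  set F : Fin m → ℝ → ℝ := fun i x => f x + γ * dyadic ψ j ((i : ℤ) * S) x with hF
  have hFmem : ∀ i, F i ∈ densityClass φ ψ s p q L T := by
    intro i
    refine h.add_mother_mem_densityClass hp hq hsp hT hf hc hδ hc0.le hc1 hc2 j ?_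
    have hi : ((i : ℕ) : ℝ) ≤ m := by exact_mod_cast i.2.le
    have : |(((i : ℤ) * S : ℤ) : ℝ)| = (i : ℕ) * S := by
      push_cast
      exact abs_of_nonneg (by positivity)
    rw [this, hw]
    have := mul_le_mul_of_nonneg_right hi hS0.le
    linarith
  have hΔ : c₁ ^ r * (∫ x, |ψ x| ^ r) * (2 : ℝ) ^ (-((j : ℝ) * (r * (s - ip) + 1))) =
      γ ^ r * ((2 : ℝ) ^ ((j : ℝ) * (r / 2 - 1)) * ∫ x, |ψ x| ^ r) := by
    rw [hγ, Real.mul_rpow hc0.le (by positivity), ← Real.rpow_mul two_pos.le]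
    have : (2 : ℝ) ^ (-((j : ℝ) * (r * (s - ip) + 1))) =
        2 ^ (-((j : ℝ) * (s + 1 / 2 - ip)) * r) * 2 ^ ((j : ℝ) * (r / 2 - 1)) := by
      rw [← Real.rpow_add two_pos]; congr 1; ring
    rw [this]; ring
  have hκ := h.integral_abs_mother_rpow_pos hr
  refine le_privateMinimaxRisk (τ := γ * (2 : ℝ) ^ (-((j : ℝ) / 2)) * ∫ x, |ψ x|) (f₀ := f) (f := F)
    hr hα (by positivity) hm0 ⟨hf.1, hf.2.1, hf.2.2.1⟩
    (fun i => ⟨(hFmem i).1, (hFmem i).2.1, (hFmem i).2.2.1⟩) hFmem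
    (fun i => (integral_abs_perturbation ψ f hγ0 j _).le) (fun i l hil => ?_) ?_
  · rw [hΔ]
    refine h.le_lintegral_sub_rpow hr f hγ0 j ?_
    have h1 : (1 : ℝ) ≤ |((i : ℕ) : ℝ) - (l : ℕ)| := by
      have h2 : ((i : ℕ) : ℤ) - (l : ℕ) ≠ 0 := by
        rw [sub_ne_zero]
        exact_mod_cast fun h3 => hil (Fin.ext h3)
      exact_mod_cast Int.one_le_abs h2
    push_cast
    rw [← sub_mul, abs_mul, abs_of_pos hS0]
    exact hS.trans_le (le_mul_of_one_le_left hS0.le h1)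
  · have e1 : n * ((Real.exp α - 1) * (γ * (2 : ℝ) ^ (-((j : ℝ) / 2)) * ∫ x, |ψ x|)) ^ 2 =
        n * (Real.exp α - 1) ^ 2 * (c₁ * ∫ x, |ψ x|) ^ 2 *
          (2 : ℝ) ^ (-((j : ℝ) * (2 * (s - ip) + 2))) := by
      have : (2 : ℝ) ^ (-((j : ℝ) * (2 * (s - ip) + 2))) =
          (2 ^ (-((j : ℝ) * (s + 1 / 2 - ip))) * 2 ^ (-((j : ℝ) / 2))) ^ 2 := by
        rw [← Real.rpow_add two_pos, ← Real.rpow_natCast, ← Real.rpow_mul two_pos.le]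
        congr 1; push_cast; ring
      rw [this, hγ]; ring
    set t := ((Real.exp α - 1) * (γ * (2 : ℝ) ^ (-((j : ℝ) / 2)) * ∫ x, |ψ x|)) ^ 2 with ht
    have ht0 : 0 ≤ t := sq_nonneg _
    -- By `1 + t ≤ e^t` the second moment is at most `e^{nt}`, and the hypothesis `hn` says exactly
    -- that `n t ≤ log w`.
    have h1 : (1 + t) ^ n ≤ w := by
      calc (1 + t) ^ n ≤ Real.exp t ^ n := by
            gcongr
            rw [add_comm]
            exact Real.add_one_le_exp t
        _ = Real.exp (n * t) := (Real.exp_nat_mul t n).symm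
        _ ≤ Real.exp ((j : ℝ) / 2 * Real.log 2) := by
            rw [e1]
            exact Real.exp_le_exp.2 hn
        _ = w := by rw [hwdef, Real.rpow_def_of_pos two_pos, mul_comm]
    linarith

/-- At the balancing level, the separation `2^{-j(rσ+1)}` is the power `-e` of `2^{jD}`, with `σ = s
- 1/p`, `D = 2σ + 2` and `e = (rσ+1)/D`. The upper bound on `2^{jD}` therefore turns into the rate,
and all constants are fixed before `α` and `n`. -/
theorem exists_le_privateMinimaxRisk (h : IsBoundedPair N φ ψ A B)
    {s : ℝ} {p q : ℝ≥0∞} {r L T : ℝ} (hp : 1 ≤ p) (hq : 1 ≤ q)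
    (hr : 1 ≤ r) (hsN : s < N + 1) (hsp : (1 / p).toReal ≤ s) (hL : 0 < L) (hT : 0 < T)
    (hne : ∃ f ∈ densityClass φ ψ s p q L T, besovJ φ ψ s p q f < ENNReal.ofReal L) :
    ∃ C > 0, ∃ m₀ : ℝ, ∀ α : ℝ, 0 < α → ∀ n : ℕ, m₀ ≤ n * (Real.exp α - 1) ^ 2 →
      ENNReal.ofReal (C * (Real.log (n * (Real.exp α - 1) ^ 2) / (n * (Real.exp α - 1) ^ 2)) ^
          (r * (s - (1 / p).toReal + 1 / r) / (2 * (s - (1 / p).toReal) + 2))) ≤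
        privateMinimaxRisk.{u} r n α (densityClass φ ψ s p q L T) := by
  obtain ⟨f, hf, c, hc0, δ, hδ0, hc, hδ⟩ := h.exists_center hp hq hsN hL hT hne
  have hA := h.pos
  have hB := h.bound_nonneg
  have hκ := h.integral_abs_mother_rpow_pos hr
  set c₁ := min δ (c / (B + 1)) with hc₁
  have hc₁0 : 0 < c₁ := lt_min hδ0 (by positivity)
  have hc₁B : c₁ * B ≤ c := by
    have h1 : c₁ ≤ c / (B + 1) := min_le_right _ _
    rw [le_div_iff₀ (by positivity)] at h1
    linarith
  obtain ⟨S, hS⟩ := exists_nat_gt (2 * A)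
  set σ := s - (1 / p).toReal with hσ
  have hσ0 : 0 ≤ σ := sub_nonneg.2 hsp
  set D := 2 * σ + 2 with hD
  have hD0 : 0 < D := by positivity
  set c₂ := (c₁ * ∫ x, |ψ x|) ^ 2 with hc₂
  set a := 1 + 4 * D * c₂ with ha
  have ha1 : 1 ≤ a := by
    have : 0 ≤ 4 * D * c₂ := by positivity
    linarith
  obtain ⟨m₀, hm₀⟩ := exists_level (D := D) (a := a) (G := 1 + 4 * A / T + 32 * S / T) (c := c₂) hD0
    ha1 (by positivity) (by linarith) (by positivity)
  set e := (r * σ + 1) / D with he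
  have he0 : 0 ≤ e := by positivity
  refine ⟨c₁ ^ r * (∫ x, |ψ x| ^ r) * 2 ^ (-(r + 1)) * (2 ^ D * a) ^ (-e), by positivity, m₀,
    fun α hα n hn => ?_⟩
  obtain ⟨hy0, j, hj1, hj2, hj3⟩ := hm₀ _ hn
  refine le_trans (ENNReal.ofReal_le_ofReal ?_) (h.le_privateMinimaxRisk_of_level hp hq hr hsp hT hf hc
    hδ hc₁0 (min_le_left _ _) hc₁B hS j hα.le n hj1 hj2)
  set y := Real.log (n * (Real.exp α - 1) ^ 2) / (n * (Real.exp α - 1) ^ 2) with hy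
  have hexp : r * (σ + 1 / r) / D = e := by
    rw [he]; congr 1; field_simp
  rw [hexp]
  have h1 : (2 ^ D * a) ^ (-e) * y ^ e ≤ (2 : ℝ) ^ (-((j : ℝ) * (r * σ + 1))) := by
    have e1 : (2 ^ D * a) ^ (-e) * y ^ e = (2 ^ D * a * y⁻¹) ^ (-e) := by
      rw [Real.mul_rpow (x := 2 ^ D * a) (y := y⁻¹) (by positivity) (by positivity), Real.inv_rpow hy0.le,
        Real.rpow_neg hy0.le, inv_inv]
    have e2 : (2 : ℝ) ^ (-((j : ℝ) * (r * σ + 1))) = ((2 : ℝ) ^ ((j : ℝ) * D)) ^ (-e) := by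
      rw [← Real.rpow_mul two_pos.le, he]
      congr 1
      field_simp
    rw [e1, e2]
    exact Real.rpow_le_rpow_of_nonpos (by positivity) hj3 (neg_nonpos.2 he0)
  have h2 : 0 ≤ c₁ ^ r * (∫ x, |ψ x| ^ r) * 2 ^ (-(r + 1)) := by positivity
  calc _ = c₁ ^ r * (∫ x, |ψ x| ^ r) * 2 ^ (-(r + 1)) * ((2 ^ D * a) ^ (-e) * y ^ e) := by ring
    _ ≤ c₁ ^ r * (∫ x, |ψ x| ^ r) * 2 ^ (-(r + 1)) * (2 : ℝ) ^ (-((j : ℝ) * (r * σ + 1))) := by gcongr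
    _ = _ := by ring

end IsBoundedPair

end LDPBesov

/-- The density class depends on the wavelets only through integrals, hence only on their almost
everywhere classes, so bounded representatives may be used. -/
theorem proposition2p2 (φ ψ : ℝ → ℝ) (N : ℕ) (hW : LDPBesov.IsWaveletPair N φ ψ)
    (s : ℝ) (p q : ℝ≥0∞) (r L T : ℝ)
    (hp : 1 ≤ p) (hq : 1 ≤ q) (hr : 1 ≤ r) (hs : 0 < s) (hsN : s < N + 1)
    (hsp : (1 / p).toReal ≤ s) (hL : 0 < L) (hT : 0 < T)
    (hne : ∃ f ∈ LDPBesov.densityClass φ ψ s p q L T,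
      LDPBesov.besovJ φ ψ s p q f < ENNReal.ofReal L) :
    ∃ C > 0, ∃ m₀ : ℝ, ∀ α : ℝ, 0 < α → ∀ n : ℕ, m₀ ≤ n * (Real.exp α - 1) ^ 2 →
      ENNReal.ofReal (C * (Real.log (n * (Real.exp α - 1) ^ 2) / (n * (Real.exp α - 1) ^ 2)) ^
          (r * (s - (1 / p).toReal + 1 / r) / (2 * (s - (1 / p).toReal) + 2))) ≤
        LDPBesov.privateMinimaxRisk.{u} r n α (LDPBesov.densityClass φ ψ s p q L T) := by
  obtain ⟨φ', ψ', A, B, h, hφ, hψ⟩ := hW.exists_isBoundedPair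
  rw [LDPBesov.densityClass_congr hφ hψ, LDPBesov.besovJ_congr hφ hψ] at hne
  rw [LDPBesov.densityClass_congr hφ hψ]
  exact h.exists_le_privateMinimaxRisk hp hq hr hsN hsp hL hT hne
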